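/- There exist universal constants $c, C > 0$ such that the following holds. Let $\delta \in (0,1/2)$, $d \ge 1$, $\sigma > 0$, and let $A_* \in \mathbb{R}^{d\times d}$ be marginally stable, i.e. its spectral radius (over $\mathbb{C}$) satisfies $\rho(A_*) \le 1$. Consider the linear dynamical system $X_{t+1} = A_* X_t + \eta_t$, $t \ge 0$, with $X_0 = 0$ and $\eta_0, \eta_1, \dots$ i.i.d. with law $\mathcal{N}(0,\sigma^2 I_d)$. For $t \ge 0$ let $\Gamma_t := \sum_{s=0}^{t-1} A_*^s (A_*^s)^\top$ be the finite-time controllability Gramian, and for $T\ge 1$ let $$\widehat{A}(T) \in \operatorname*{arg\,min}_{A \in \mathbb{R}^{d\times d}} \sum_{t=1}^T \tfrac12 \|X_{t+1} - A X_t\|_2^2$$ be any ordinary least-squares estimator. Then, for all integers $T$ and $k$ with $1 \le k \le T$ and $$\frac{T}{k} \ge c\left(d\log\frac{d}{\delta} + \log\det(\Gamma_T\Gamma_k^{-1})\right),$$ one has $$\Pr\left[\big\|\widehat{A}(T) - A_*\big\|_{\mathrm{op}} > \frac{C}{\sqrt{T\lambda_{\min}(\Gamma_k)}}\sqrt{d\log\frac{d}{\delta}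 + \log\det(\Gamma_T\Gamma_k^{-1})}\,\right] \le \delta,$$ where $\lambda_{\min}$ denotes the smallest eigenvalue and $\|\cdot\|_{\mathrm{op}}$ the $\ell_2\to\ell_2$ operator norm. -/

import Mathlib

open MeasureTheory ProbabilityTheory

namespace LinSys

/-- The finite-time controllability Gramian `Γ_t = ∑_{s=0}^{t-1} A^s (A^s)ᵀ`. -/
noncomputable def gramian {d : ℕ} (A : Matrix (Fin d) (Fin d) ℝ) (t : ℕ) :
    Matrix (Fin d) (Fin d) ℝ :=
  ∑ s ∈ Finset.range t, A ^ s * (A ^ s).transpose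

theorem gramian_isHermitian {d : ℕ} (A : Matrix (Fin d) (Fin d) ℝ) (t : ℕ) :
    (gramian A t).IsHermitian := by
  unfold gramian
  rw [Matrix.IsHermitian, Matrix.conjTranspose_sum]
  refine Finset.sum_congr rfl fun s _ => ?_
  rw [Matrix.conjTranspose_mul, Matrix.conjTranspose_eq_transpose_of_trivial,
    Matrix.conjTranspose_eq_transpose_of_trivial, Matrix.transpose_transpose]

/-- The smallest eigenvalue of the (symmetric) Gramian `Γ_t`. -/
noncomputable def gramianLambdaMin {d : ℕ} (A : Matrix (Fin d) (Fin d) ℝ) (t : ℕ) : ℝ :=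
  ⨅ i : Fin d, (gramian_isHermitian A t).eigenvalues i

/-- The quantity `d log(d/δ) + log det(Γ_T Γ_k⁻¹)`. -/
noncomputable def complexityTerm {d : ℕ} (A : Matrix (Fin d) (Fin d) ℝ) (δ : ℝ) (T k : ℕ) : ℝ :=
  d * Real.log (d / δ) + Real.log (gramian A T * (gramian A k)⁻¹).det

/-- The least-squares objective `∑_{t=1}^T ½ ‖x_{t+1} - A x_t‖₂²` along a trajectory `x`. -/
noncomputable def olsLoss {d : ℕ} (x : ℕ → EuclideanSpace ℝ (Fin d)) (T : ℕ)
    (A : Matrix (Fin d) (Fin d) ℝ) : ℝ :=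
  ∑ t ∈ Finset.Icc 1 T, (1 / 2 : ℝ) * ‖x (t + 1) - Matrix.toEuclideanCLM (𝕜 := ℝ) A (x t)‖ ^ 2

/-- `Ahat` is a least-squares estimate (a global minimiser of the least-squares objective) computed
from the trajectory `x_1, …, x_{T+1}`. -/
def IsOLS {d : ℕ} (x : ℕ → EuclideanSpace ℝ (Fin d)) (T : ℕ)
    (Ahat : Matrix (Fin d) (Fin d) ℝ) : Prop :=
  ∀ B : Matrix (Fin d) (Fin d) ℝ, olsLoss x T Ahat ≤ olsLoss x T B

/-- The `ℓ₂ → ℓ₂` operator norm of a matrix. -/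
noncomputable def opNorm {d : ℕ} (M : Matrix (Fin d) (Fin d) ℝ) : ℝ :=
  ‖Matrix.toEuclideanCLM (𝕜 := ℝ) M‖

end LinSys

/-!
# Least-squares identification of a linear system without mixing

Write `q(w) = ∑_{t=1}^T ⟪w, X_t⟫²` for the empirical covariance form, and `g_k` for the quadratic
form of the Gramian `Γ_k`. After dividing by `σ` the noise is standard. The estimation error
`D = Â - A` satisfies the normal equations `D ∑ X_t X_tᵀ = ∑ η_t X_tᵀ`, and three facts are played
against each other. Coverings are replaced throughout by volumes: a Laplace functional that is small
in expectation for each fixed direction is integrated over directions, and a single bad direction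
forces a whole neighbourhood of bad directions, hence a large integral.

* Upper bound (`IsStdGaussianNoise.measure_heavy_le`). Since `E q ≤ T g_T`, with probability at
  least `1 - δ/3` the form `q` is at most `α T` on half of the volume of the ellipsoid
  `g_T ≤ α δ / 6`.
* Lower bound (`IsStdGaussianNoise.measure_shell_le`). Given the noise before time `s`, the state
  `X_{s+k}` is Gaussian with covariance `Γ_k`, so `E exp (-(6/k) q(w))` is at most `2^{-n}`, with
  `n + 1 = ⌊T/k⌋`, on the shell `1/4 ≤ g_k ≤ 9/4`. If `q(u) < α T` with `g_k(u) = 1`, then the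
  translate by `u` of the light half-ellipsoid lies in the shell and `q ≤ 4 α T` on it. The ratio of
  volumes is `(C / √δ)^d` times `(det Γ_T / det Γ_k)^{1/2}`, which the burn-in condition on `T / k`
  absorbs. Hence `q ≥ α T g_k` everywhere.
* Self-normalised noise (`IsStdGaussianNoise.lintegral_exp_cross_le_one`,
  `NormalEquations.volume_mul_exp_le`). For fixed `v, w` the exponential of
  `∑ ⟪v, η_t⟫ ⟪w, X_t⟫ - ‖v‖² q(w) / 2` has mean at most `1`. It is integrated over `v` in a ball and
  over `w` with Gaussian weight `exp (-g_k / 2)`. By the normal equations, completing the square in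
  `w` yields the exponential of a multiple of `q(D* v) ≥ α T λ_min(Γ_k) ‖D* v‖²`, for all `v` in a
  small ball around a near-maximiser of `‖D* v‖`; so `‖D‖` cannot be large.

The volumes enter through `volume_setOf_norm_linearMap_le`, applied to square roots of `Γ_k` and
`Γ_T`, and through the crude bound `Γ(d/2 + 1) ≤ d^d`, affordable because of the term
`d log (d/δ)`.
-/

/-! ### Volumes of ellipsoids and Gaussian integrals -/

section Geometry

variable {E : Type*} [NormedAddCommGroup E] [InnerProductSpace ℝ E] [FiniteDimensional ℝ E]
  [MeasurableSpace E] [BorelSpace E]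

theorem volume_setOf_norm_linearMap_le (L : E →ₗ[ℝ] E) (hL : LinearMap.det L ≠ 0) {r : ℝ}
    (hr : 0 ≤ r) :
    volume {w : E | ‖L w‖ ≤ r} =
      ENNReal.ofReal (|(LinearMap.det L)⁻¹| * r ^ Module.finrank ℝ E)
        * volume (Metric.ball (0 : E) 1) := by
  have h := Measure.addHaar_preimage_linearMap (volume : Measure E) hL (Metric.closedBall 0 r)
  have hs : (L ⁻¹' Metric.closedBall 0 r) = {w : E | ‖L w‖ ≤ r} := by
    ext w; simp
  rw [hs, Measure.addHaar_closedBall _ _ hr, ← mul_assoc, ← ENNReal.ofReal_mul (abs_nonneg _)] at h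
  exact h

theorem lintegral_comp_linearMap (L : E →ₗ[ℝ] E) (hL : LinearMap.det L ≠ 0) {f : E → ENNReal}
    (hf : Measurable f) :
    ∫⁻ w, f (L w) = ENNReal.ofReal |(LinearMap.det L)⁻¹| * ∫⁻ x, f x := by
  have h := Measure.map_linearMap_addHaar_eq_smul_addHaar (volume : Measure E) hL
  rw [← lintegral_map hf L.continuous_of_finiteDimensional.measurable, h, lintegral_smul_measure,
    smul_eq_mul]

theorem lintegral_exp_neg_norm_sq_div_two :
    ∫⁻ x : E, ENNReal.ofReal (Real.exp (-‖x‖ ^ 2 / 2))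
      = ENNReal.ofReal (√(2 * Real.pi) ^ Module.finrank ℝ E) := by
  have h := GaussianFourier.integral_rexp_neg_mul_sq_norm (V := E) (b := 1 / 2) (by norm_num)
  have hpos : 0 < ∫ v : E, Real.exp (-(1 / 2) * ‖v‖ ^ 2) := by rw [h]; positivity
  have hint : Integrable fun v : E => Real.exp (-(1 / 2) * ‖v‖ ^ 2) := by
    by_contra hn
    rw [integral_undef hn] at hpos
    exact lt_irrefl _ hpos
  have hfun : ∀ x : E, -‖x‖ ^ 2 / 2 = -(1 / 2) * ‖x‖ ^ 2 := fun x => by ring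
  simp only [hfun]
  rw [← ofReal_integral_eq_lintegral_ofReal hint (ae_of_all _ fun _ => (Real.exp_pos _).le),
    h]
  congr 1
  rw [Real.sqrt_eq_rpow, ← Real.rpow_natCast, ← Real.rpow_mul (by positivity)]
  congr 1 <;> ring

theorem lintegral_exp_neg_norm_linearMap_sq (L : E →ₗ[ℝ] E) (hL : LinearMap.det L ≠ 0) :
    ∫⁻ w : E, ENNReal.ofReal (Real.exp (-‖L w‖ ^ 2 / 2))
      = ENNReal.ofReal (|(LinearMap.det L)⁻¹| * √(2 * Real.pi) ^ Module.finrank ℝ E) := by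
  rw [lintegral_comp_linearMap L hL (f := fun x => ENNReal.ofReal (Real.exp (-‖x‖ ^ 2 / 2)))
    (by fun_prop), lintegral_exp_neg_norm_sq_div_two, ← ENNReal.ofReal_mul (abs_nonneg _)]

/-- Comparing the volumes of the unit ellipsoids turns domination of quadratic forms into
domination of determinants. -/
theorem abs_det_le_of_norm_le (L M : E →ₗ[ℝ] E) (hL : LinearMap.det L ≠ 0)
    (hM : LinearMap.det M ≠ 0) (h : ∀ w, ‖L w‖ ≤ ‖M w‖) :
    |LinearMap.det L| ≤ |LinearMap.det M| := by
  have h1 : volume {w : E | ‖M w‖ ≤ 1} ≤ volume {w : E | ‖L w‖ ≤ 1} :=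
    measure_mono fun w hw => (h w).trans hw
  rw [volume_setOf_norm_linearMap_le M hM zero_le_one,
    volume_setOf_norm_linearMap_le L hL zero_le_one] at h1
  have hb0 : volume (Metric.ball (0 : E) 1) ≠ 0 :=
    (Metric.measure_ball_pos volume (0 : E) one_pos).ne'
  have hbt : volume (Metric.ball (0 : E) 1) ≠ ⊤ := measure_ball_lt_top.ne
  have h2 := (ENNReal.mul_le_mul_iff_left hb0 hbt).1 h1
  simp only [one_pow, mul_one, abs_inv] at h2
  rw [ENNReal.ofReal_le_ofReal_iff (by positivity)] at h2
  exact (inv_le_inv₀ (abs_pos.2 hM) (abs_pos.2 hL)).1 h2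

end Geometry

/-- Convexity of `Γ` on `[1, d + 1]` gives a crude bound on the inverse volume of the unit ball. -/
theorem gamma_half_add_one_le (d : ℕ) (hd : 1 ≤ d) :
    Real.Gamma ((d : ℝ) / 2 + 1) ≤ (d : ℝ) ^ d := by
  have hd' : (1 : ℝ) ≤ d := by exact_mod_cast hd
  have hy : (d : ℝ) + 1 ∈ Set.Ioi (0 : ℝ) := by simp only [Set.mem_Ioi]; positivity
  have hc := Real.convexOn_Gamma.right (Set.mem_Ioi.2 (zero_lt_one' ℝ)) hy
    (show (0 : ℝ) ≤ 1 / 2 by norm_num) (show (0 : ℝ) ≤ 1 / 2 by norm_num) (by norm_num)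
  have hx : (1 / 2 : ℝ) • (1 : ℝ) + (1 / 2 : ℝ) • ((d : ℝ) + 1) = (d : ℝ) / 2 + 1 := by
    simp only [smul_eq_mul]; ring
  rw [hx, Real.Gamma_one, Real.Gamma_nat_eq_factorial] at hc
  have h1 : ((d.factorial : ℕ) : ℝ) ≤ (d : ℝ) ^ d := by exact_mod_cast Nat.factorial_le_pow d
  have h2 : (1 : ℝ) ≤ (d : ℝ) ^ d := one_le_pow₀ hd'
  simp only [smul_eq_mul] at hc
  linarith

theorem volume_unitBall_euclideanSpace (d : ℕ) (hd : 1 ≤ d) :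
    volume (Metric.ball (0 : EuclideanSpace ℝ (Fin d)) 1)
      = ENNReal.ofReal (√Real.pi ^ d / Real.Gamma ((d : ℝ) / 2 + 1)) := by
  have : Nonempty (Fin d) := ⟨⟨0, hd⟩⟩
  rw [EuclideanSpace.volume_ball]
  simp

/-! ### Gaussian noise and the linear response to it -/

/-- Integrating a function of two independent variables, one variable at a time. -/
theorem ProbabilityTheory.IndepFun.lintegral_prodMk {Ω α β : Type*} [MeasurableSpace Ω]
    [MeasurableSpace α] [MeasurableSpace β] {μ : Measure Ω} [IsProbabilityMeasure μ]
    {U : Ω → α} {Y : Ω → β} (h : IndepFun U Y μ) (hU : Measurable U) (hY : Measurable Y)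
    {F : α × β → ENNReal} (hF : Measurable F) :
    ∫⁻ ω, F (U ω, Y ω) ∂μ = ∫⁻ ω, ∫⁻ y, F (U ω, y) ∂(μ.map Y) ∂μ := by
  have : IsProbabilityMeasure (μ.map U) := Measure.isProbabilityMeasure_map hU.aemeasurable
  have : IsProbabilityMeasure (μ.map Y) := Measure.isProbabilityMeasure_map hY.aemeasurable
  have h1 := (indepFun_iff_map_prod_eq_prod_map_map hU.aemeasurable hY.aemeasurable).1 h
  rw [← lintegral_map (f := F) (g := fun ω => (U ω, Y ω)) hF (hU.prodMk hY), h1,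
    lintegral_prod _ hF.aemeasurable, lintegral_map hF.lintegral_prod_right' hU]

/-- The Laplace transform of the square of a Gaussian variable is largest when it is centred. -/
theorem lintegral_exp_neg_sq_gaussianReal_le (v : NNReal) {b : ℝ} (hb : 0 ≤ b) (m : ℝ) :
    ∫⁻ x, ENNReal.ofReal (Real.exp (-b * (m + x) ^ 2)) ∂(gaussianReal 0 v)
      ≤ ENNReal.ofReal (1 / √(1 + 2 * b * v)) := by
  by_cases hv : v = 0
  · subst hv
    simp only [gaussianReal_zero_var, NNReal.coe_zero, mul_zero, add_zero, Real.sqrt_one, div_one,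
      ENNReal.ofReal_one]
    rw [lintegral_dirac]
    refine ENNReal.ofReal_le_one.2 (Real.exp_le_one_iff.2 ?_)
    nlinarith [sq_nonneg (m + 0)]
  have hv' : (0 : ℝ) < v := by positivity
  rw [gaussianReal_of_var_ne_zero _ hv,
    lintegral_withDensity_eq_lintegral_mul _ (measurable_gaussianPDF 0 v) (by fun_prop)]
  set β : ℝ := b + 1 / (2 * v) with hβ
  have hβ0 : 0 < β := by positivity
  set c : ℝ := b * m / β with hc
  -- completing the square leaves the shifted centre `c` and a nonpositive constant
  have hpt : ∀ x : ℝ, (gaussianPDF 0 v * fun x => ENNReal.ofReal (Real.exp (-b * (m + x) ^ 2))) x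
      ≤ ENNReal.ofReal ((√(2 * Real.pi * v))⁻¹ * Real.exp (-β * (x + c) ^ 2)) := by
    intro x
    rw [Pi.mul_apply, gaussianPDF, ← ENNReal.ofReal_mul (gaussianPDFReal_nonneg _ _ _)]
    refine ENNReal.ofReal_le_ofReal ?_
    rw [gaussianPDFReal, mul_assoc, ← Real.exp_add]
    refine mul_le_mul_of_nonneg_left (Real.exp_le_exp.2 ?_) (by positivity)
    have e1 : -(x - 0) ^ 2 / (2 * (v : ℝ)) + -b * (m + x) ^ 2
        = -β * (x + c) ^ 2 - (b * m ^ 2 - b ^ 2 * m ^ 2 / β) := by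
      have hcβ : β * c = b * m := by rw [hc]; field_simp
      have h2 : β * c ^ 2 = b ^ 2 * m ^ 2 / β := by rw [hc]; field_simp
      have : -β * (x + c) ^ 2 = -β * x ^ 2 - 2 * (β * c) * x - β * c ^ 2 := by ring
      rw [this, hcβ, h2, hβ]; ring
    rw [e1]
    have h3 : b ^ 2 * m ^ 2 / β ≤ b * m ^ 2 := by
      rw [div_le_iff₀ hβ0]
      have : b ≤ β := by rw [hβ]; linarith [show 0 < 1 / (2 * (v : ℝ)) by positivity]
      nlinarith [mul_nonneg hb (sq_nonneg m)]
    linarith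
  refine (lintegral_mono hpt).trans ?_
  have hint : Integrable fun x : ℝ => (√(2 * Real.pi * v))⁻¹ * Real.exp (-β * (x + c) ^ 2) :=
    ((integrable_exp_neg_mul_sq hβ0).comp_add_right c).const_mul _
  rw [← ofReal_integral_eq_lintegral_ofReal hint (ae_of_all _ fun x => by positivity),
    integral_const_mul, integral_add_right_eq_self (fun x : ℝ => Real.exp (-β * x ^ 2)),
    integral_gaussian]
  refine ENNReal.ofReal_le_ofReal (le_of_eq ?_)
  rw [← Real.sqrt_inv, ← Real.sqrt_mul (by positivity), one_div, ← Real.sqrt_inv]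
  congr 1
  rw [hβ]
  have := Real.pi_pos
  field_simp
  ring

theorem lintegral_sq_gaussianReal (v : NNReal) :
    ∫⁻ x, ENNReal.ofReal (x ^ 2) ∂(gaussianReal 0 v) = v := by
  have h2 : MemLp id 2 (gaussianReal 0 v) := memLp_id_gaussianReal 2
  have hv := variance_id_gaussianReal (μ := 0) (v := v)
  rw [variance_of_integral_eq_zero aemeasurable_id (by simp)] at hv
  have hi : Integrable (fun x : ℝ => x ^ 2) (gaussianReal 0 v) := h2.integrable_sq
  rw [← ofReal_integral_eq_lintegral_ofReal hi (ae_of_all _ fun x => sq_nonneg x)]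
  simp only [id] at hv ⊢
  rw [hv, ENNReal.ofReal_coe_nnreal]

theorem lintegral_exp_gaussianReal (v : NNReal) (t : ℝ) :
    ∫⁻ x, ENNReal.ofReal (Real.exp (t * x)) ∂(gaussianReal 0 v)
      = ENNReal.ofReal (Real.exp (v * t ^ 2 / 2)) := by
  rw [← ofReal_integral_eq_lintegral_ofReal (integrable_exp_mul_gaussianReal t)
    (ae_of_all _ fun x => (Real.exp_pos _).le)]
  have := congrFun (mgf_id_gaussianReal (μ := 0) (v := v)) t
  simp only [mgf, id, zero_mul, zero_add] at this
  rw [this]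

section Noise

set_option linter.unusedSectionVars false

variable {E : Type*} [NormedAddCommGroup E] [InnerProductSpace ℝ E] [FiniteDimensional ℝ E]
  [MeasurableSpace E] [BorelSpace E] {Ω : Type*} [MeasurableSpace Ω]

open scoped RealInnerProductSpace

/-- `η` is a sequence of independent standard Gaussian vectors. The law is prescribed through the
one-dimensional marginals `⟪u, η t⟫ ∼ 𝒩(0, ‖u‖²)`. -/
structure IsStdGaussianNoise (η : ℕ → Ω → E) (μ : Measure Ω) : Prop where
  measurable : ∀ t, Measurable (η t)
  indep : iIndepFun η μ
  map_inner : ∀ t u, μ.map (fun ω => ⟪u, η t ω⟫) = gaussianReal 0 (‖u‖₊ ^ 2)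

/-- The state reached at time `s + k` by the system `x ↦ a x + η` started at `0` at time `s`.
The trajectory started at time `0` is `linearResponse a η 0`. -/
def linearResponse (a : E →L[ℝ] E) (η : ℕ → Ω → E) (s : ℕ) : ℕ → Ω → E
  | 0, _ => 0
  | k + 1, ω => a (linearResponse a η s k ω) + η (s + k) ω

/-- The quadratic form `w ↦ ∑_{s<k} ‖(a*)^s w‖²` of the controllability Gramian `Γ_k`. -/
noncomputable def gramianForm (a : E →L[ℝ] E) (k : ℕ) (w : E) : NNReal :=
  ∑ s ∈ Finset.range k, ‖(a.adjoint ^ s) w‖₊ ^ 2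

theorem gramianForm_succ (a : E →L[ℝ] E) (k : ℕ) (w : E) :
    gramianForm a (k + 1) w = gramianForm a k (a.adjoint w) + ‖w‖₊ ^ 2 := by
  simp only [gramianForm, Finset.sum_range_succ', pow_zero, pow_succ]
  rfl

theorem gramianForm_mono (a : E →L[ℝ] E) (w : E) : Monotone fun k => gramianForm a k w := by
  intro k l h
  exact Finset.sum_le_sum_of_subset (Finset.range_mono h)

theorem norm_sq_le_gramianForm (a : E →L[ℝ] E) {k : ℕ} (hk : 1 ≤ k) (w : E) :
    ‖w‖ ^ 2 ≤ gramianForm a k w := by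
  have h : gramianForm a 1 w ≤ gramianForm a k w := gramianForm_mono a w hk
  rw [gramianForm, Finset.sum_range_one, pow_zero, one_apply_eq_self] at h
  exact_mod_cast h

/-- The σ-algebra generated by the noise at the times in `S`. -/
abbrev noiseSigma (η : ℕ → Ω → E) (S : Set ℕ) : MeasurableSpace Ω :=
  ⨆ i ∈ S, MeasurableSpace.comap (η i) inferInstance

variable {η : ℕ → Ω → E} {μ : Measure Ω} [IsProbabilityMeasure μ] (a : E →L[ℝ] E)

theorem noiseSigma_mono {S S' : Set ℕ} (h : S ⊆ S') : noiseSigma η S ≤ noiseSigma η S' :=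
  biSup_mono fun _ hi => h hi

theorem measurable_noiseSigma {S : Set ℕ} {i : ℕ} (hi : i ∈ S) :
    Measurable[noiseSigma η S] (η i) := by
  rw [measurable_iff_comap_le]
  exact le_biSup (fun i => MeasurableSpace.comap (η i) inferInstance) hi

theorem IsStdGaussianNoise.noiseSigma_le (h : IsStdGaussianNoise η μ) (S : Set ℕ) :
    noiseSigma η S ≤ ‹MeasurableSpace Ω› :=
  iSup₂_le fun i _ => (h.measurable i).comap_le

theorem IsStdGaussianNoise.indepFun (h : IsStdGaussianNoise η μ) {S S' : Set ℕ}
    (hS : Disjoint S S') {α β : Type*} [MeasurableSpace α] [MeasurableSpace β] {U : Ω → α}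
    {Y : Ω → β} (hU : Measurable[noiseSigma η S] U) (hY : Measurable[noiseSigma η S'] Y) :
    IndepFun U Y μ := by
  rw [IndepFun_iff_Indep]
  exact indep_of_indep_of_le_left (indep_of_indep_of_le_right
    (indep_iSup_of_disjoint (fun i => (h.measurable i).comap_le) h.indep.iIndep hS)
    hY.comap_le) hU.comap_le

theorem measurable_linearResponse (s k : ℕ) :
    Measurable[noiseSigma η (Set.Ico s (s + k))] (linearResponse a η s k) := by
  induction k with
  | zero => exact measurable_const
  | succ k ih =>
    have h1 : Measurable[noiseSigma η (Set.Ico s (s + (k + 1)))] (linearResponse a η s k) :=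
      ih.mono (noiseSigma_mono (Set.Ico_subset_Ico_right (by lia))) le_rfl
    exact (a.continuous.measurable.comp h1).add
      (measurable_noiseSigma (Set.mem_Ico.2 ⟨by lia, by lia⟩))

theorem linearResponse_add (s k : ℕ) (ω : Ω) :
    linearResponse a η 0 (s + k) ω
      = (a ^ k) (linearResponse a η 0 s ω) + linearResponse a η s k ω := by
  induction k with
  | zero => simp [linearResponse]
  | succ k ih =>
    rw [← add_assoc, linearResponse, linearResponse, ih, zero_add, map_add, pow_succ', add_assoc]
    rfl

/-- The response to `k` steps of noise is Gaussian with covariance the Gramian `Γ_k`. -/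
theorem IsStdGaussianNoise.map_inner_linearResponse (h : IsStdGaussianNoise η μ) (s k : ℕ) (w : E) :
    μ.map (fun ω => ⟪w, linearResponse a η s k ω⟫) = gaussianReal 0 (gramianForm a k w) := by
  induction k generalizing w with
  | zero => simp [linearResponse, gramianForm]
  | succ k ih =>
    have hind : IndepFun (fun ω => ⟪a.adjoint w, linearResponse a η s k ω⟫)
        (fun ω => ⟪w, η (s + k) ω⟫) μ :=
      h.indepFun (S := Set.Ico s (s + k)) (S' := {s + k}) (by simp)
        ((Continuous.measurable (by fun_prop : Continuous fun x => ⟪a.adjoint w, x⟫)).comp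
          (measurable_linearResponse a s k))
        ((Continuous.measurable (by fun_prop : Continuous fun x => ⟪w, x⟫)).comp
          (measurable_noiseSigma rfl))
    have := gaussianReal_add_gaussianReal_of_indepFun hind (ih _) (h.map_inner _ w)
    rw [gramianForm_succ, ← zero_add (0 : ℝ), ← this]
    congr 1
    funext ω
    simp [linearResponse, inner_add_right, ContinuousLinearMap.adjoint_inner_left]

theorem IsStdGaussianNoise.measurable_response (h : IsStdGaussianNoise η μ) (s k : ℕ) :
    Measurable (linearResponse a η s k) :=
  (measurable_linearResponse a s k).mono (h.noiseSigma_le _) le_rfl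

theorem IsStdGaussianNoise.lintegral_inner_sq (h : IsStdGaussianNoise η μ) (t : ℕ) (w : E) :
    ∫⁻ ω, ENNReal.ofReal (⟪w, linearResponse a η 0 t ω⟫ ^ 2) ∂μ = gramianForm a t w := by
  have hm := h.measurable_response a 0 t
  rw [← lintegral_sq_gaussianReal, ← h.map_inner_linearResponse a 0 t w,
    lintegral_map (by fun_prop) (by fun_prop)]

/-- Conditionally on the noise before time `s`, the state at time `s + k` has covariance `Γ_k`,
whatever its mean; this costs every Laplace functional a fixed factor. -/
theorem IsStdGaussianNoise.lintegral_mul_exp_neg_le (h : IsStdGaussianNoise η μ) (s k : ℕ) (w : E)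
    {b : ℝ} (hb : 0 ≤ b) {P : Ω → ENNReal} (hP : Measurable[noiseSigma η (Set.Iio s)] P) :
    ∫⁻ ω, P ω * ENNReal.ofReal (Real.exp (-b * ⟪w, linearResponse a η 0 (s + k) ω⟫ ^ 2)) ∂μ
      ≤ ENNReal.ofReal (1 / √(1 + 2 * b * gramianForm a k w)) * ∫⁻ ω, P ω ∂μ := by
  have hX : Measurable[noiseSigma η (Set.Iio s)]
      fun ω => ⟪w, (a ^ k) (linearResponse a η 0 s ω)⟫ :=
    (Continuous.measurable (by fun_prop : Continuous fun x => ⟪w, (a ^ k) x⟫)).comp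
      ((measurable_linearResponse a 0 s).mono
        (noiseSigma_mono fun i hi => by simpa using hi) le_rfl)
  have hU : Measurable[noiseSigma η (Set.Iio s)]
      fun ω => (P ω, ⟪w, (a ^ k) (linearResponse a η 0 s ω)⟫) := hP.prodMk hX
  have hY : Measurable[noiseSigma η (Set.Ico s (s + k))]
      fun ω => ⟪w, linearResponse a η s k ω⟫ :=
    (Continuous.measurable (by fun_prop : Continuous fun x => ⟪w, x⟫)).comp
      (measurable_linearResponse a s k)
  have hind := h.indepFun (S := Set.Iio s) (S' := Set.Ico s (s + k))
    (Set.disjoint_left.2 fun i hi hi' => by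
      simp only [Set.mem_Iio, Set.mem_Ico] at hi hi'; lia) hU hY
  have key := hind.lintegral_prodMk (hU.mono (h.noiseSigma_le _) le_rfl)
    (hY.mono (h.noiseSigma_le _) le_rfl)
    (F := fun p => p.1.1 * ENNReal.ofReal (Real.exp (-b * (p.1.2 + p.2) ^ 2))) (by fun_prop)
  simp only [← inner_add_right, ← linearResponse_add] at key
  rw [key, h.map_inner_linearResponse]
  calc _ ≤ ∫⁻ ω, P ω * ENNReal.ofReal (1 / √(1 + 2 * b * gramianForm a k w)) ∂μ := by
        refine lintegral_mono fun ω => ?_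
        simp only
        rw [lintegral_const_mul _ (by fun_prop)]
        gcongr
        exact lintegral_exp_neg_sq_gaussianReal_le _ hb _
    _ = _ := by
        rw [lintegral_mul_const _ (hP.mono (h.noiseSigma_le _) le_rfl), mul_comm]

/-- Iterating along the times `i + k, i + 2k, …, i + nk`. -/
theorem IsStdGaussianNoise.lintegral_exp_neg_stride_le (h : IsStdGaussianNoise η μ) (k i n : ℕ)
    (w : E) {b : ℝ} (hb : 0 ≤ b) :
    ∫⁻ ω, ENNReal.ofReal (Real.exp (-b * ∑ j ∈ Finset.range n,
        ⟪w, linearResponse a η 0 (k * (j + 1) + i) ω⟫ ^ 2)) ∂μ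
      ≤ ENNReal.ofReal (1 / √(1 + 2 * b * gramianForm a k w)) ^ n := by
  induction n with
  | zero => simp
  | succ n ih =>
    have hP : Measurable[noiseSigma η (Set.Iio (k * n + i))] fun ω =>
        ENNReal.ofReal (Real.exp (-b * ∑ j ∈ Finset.range n,
          ⟪w, linearResponse a η 0 (k * (j + 1) + i) ω⟫ ^ 2)) := by
      refine ENNReal.measurable_ofReal.comp (Real.measurable_exp.comp (Measurable.const_mul ?_ _))
      refine Finset.measurable_fun_sum _ fun j hj => ?_
      refine (Continuous.measurable (by fun_prop : Continuous fun x => ⟪w, x⟫ ^ 2)).comp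
        ((measurable_linearResponse a 0 _).mono (noiseSigma_mono fun l hl => ?_) le_rfl)
      have h1 : k * (j + 1) ≤ k * n := Nat.mul_le_mul_left k (Finset.mem_range.1 hj)
      simp only [Set.mem_Ico, Set.mem_Iio] at hl ⊢
      lia
    have key := h.lintegral_mul_exp_neg_le a (k * n + i) k w hb hP
    have e : ∀ ω, ENNReal.ofReal (Real.exp (-b * ∑ j ∈ Finset.range (n + 1),
        ⟪w, linearResponse a η 0 (k * (j + 1) + i) ω⟫ ^ 2)) =
        ENNReal.ofReal (Real.exp (-b * ∑ j ∈ Finset.range n,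
          ⟪w, linearResponse a η 0 (k * (j + 1) + i) ω⟫ ^ 2)) *
        ENNReal.ofReal (Real.exp (-b * ⟪w, linearResponse a η 0 (k * n + i + k) ω⟫ ^ 2)) := by
      intro ω
      rw [Finset.sum_range_succ, mul_add, Real.exp_add, ENNReal.ofReal_mul (Real.exp_pos _).le,
        show k * n + i + k = k * (n + 1) + i by ring]
    simp only [e]
    rw [pow_succ']
    exact key.trans (by gcongr)

/-- The empirical covariance form `w ↦ ∑_{t=1}^T ⟪w, X_t⟫²` of a trajectory `x`. -/
noncomputable def covForm (x : ℕ → E) (T : ℕ) (w : E) : ℝ :=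
  ∑ t ∈ Finset.Icc 1 T, ⟪w, x t⟫ ^ 2

theorem covForm_nonneg (x : ℕ → E) (T : ℕ) (w : E) : 0 ≤ covForm x T w :=
  Finset.sum_nonneg fun _ _ => sq_nonneg _

theorem sum_range_sum_range_le_sum_Icc {f : ℕ → ℝ} (hf : ∀ t, 0 ≤ f t) {k n T : ℕ} (hk : 1 ≤ k)
    (hn : k * (n + 1) ≤ T + 1) :
    ∑ i ∈ Finset.range k, ∑ j ∈ Finset.range n, f (k * (j + 1) + i)
      ≤ ∑ t ∈ Finset.Icc 1 T, f t := by
  have h1 : ∀ n, ∑ j ∈ Finset.range n, ∑ i ∈ Finset.range k, f (k * (j + 1) + i)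
      = ∑ t ∈ Finset.Ico k (k * (n + 1)), f t := by
    intro n
    induction n with
    | zero => simp
    | succ n ih =>
      rw [Finset.sum_range_succ, ih, ← Finset.sum_Ico_consecutive f
        (show k ≤ k * (n + 1) by nlinarith) (show k * (n + 1) ≤ k * (n + 1 + 1) by nlinarith),
        Finset.sum_Ico_eq_sum_range f (k * (n + 1)),
        show k * (n + 1 + 1) - k * (n + 1) = k by rw [mul_add k (n + 1) 1]; simp]
  rw [Finset.sum_comm, h1]
  refine Finset.sum_le_sum_of_subset_of_nonneg (fun t ht => ?_) fun t _ _ => hf t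
  simp only [Finset.mem_Ico, Finset.mem_Icc] at ht ⊢
  lia

/-- Small-ball bound for the empirical covariance in a fixed direction: by Jensen's inequality it
suffices to treat the `k` arithmetic progressions of step `k` separately. -/
theorem IsStdGaussianNoise.lintegral_exp_neg_covForm_le (h : IsStdGaussianNoise η μ) {k n T : ℕ}
    (hk : 1 ≤ k) (hn : k * (n + 1) ≤ T + 1) (w : E) {b : ℝ} (hb : 0 ≤ b) :
    ∫⁻ ω, ENNReal.ofReal (Real.exp (-(b / k) * covForm (fun t => linearResponse a η 0 t ω) T w)) ∂μ
      ≤ ENNReal.ofReal (1 / √(1 + 2 * b * gramianForm a k w)) ^ n := by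
  have hk0 : (0 : ℝ) < k := by exact_mod_cast hk
  set S : ℕ → Ω → ℝ := fun i ω => ∑ j ∈ Finset.range n,
    ⟪w, linearResponse a η 0 (k * (j + 1) + i) ω⟫ ^ 2 with hS
  have hm := h.measurable_response a 0
  have hSm : ∀ i, Measurable (S i) := fun i => by
    simp only [hS]; fun_prop
  have hpt : ∀ ω, ENNReal.ofReal
      (Real.exp (-(b / k) * covForm (fun t => linearResponse a η 0 t ω) T w))
      ≤ ∑ i ∈ Finset.range k, ENNReal.ofReal (1 / k) * ENNReal.ofReal (Real.exp (-b * S i ω)) := by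
    intro ω
    have h1 : ∑ i ∈ Finset.range k, S i ω ≤ covForm (fun t => linearResponse a η 0 t ω) T w :=
      sum_range_sum_range_le_sum_Icc
        (f := fun t => ⟪w, linearResponse a η 0 t ω⟫ ^ 2) (fun t => sq_nonneg _) hk hn
    have h2 := convexOn_exp.map_sum_le (t := Finset.range k) (w := fun _ => 1 / (k : ℝ))
      (p := fun i => -b * S i ω) (fun _ _ => by positivity)
      (by simp [hk0.ne']) (fun _ _ => Set.mem_univ _)
    simp only [smul_eq_mul] at h2
    simp only [← ENNReal.ofReal_mul (show (0 : ℝ) ≤ 1 / k by positivity)]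
    rw [← ENNReal.ofReal_sum_of_nonneg fun i _ => by positivity]
    refine ENNReal.ofReal_le_ofReal (le_trans (Real.exp_le_exp.2 ?_) h2)
    have : ∑ i ∈ Finset.range k, 1 / (k : ℝ) * (-b * S i ω)
        = -(b / k) * ∑ i ∈ Finset.range k, S i ω := by
      rw [Finset.mul_sum]
      exact Finset.sum_congr rfl fun i _ => by ring
    rw [this]
    have : 0 ≤ b / k := by positivity
    nlinarith
  refine (lintegral_mono hpt).trans ?_
  rw [lintegral_finsetSum _ fun i _ => by have := hSm i; fun_prop]
  calc _ ≤ ∑ _i ∈ Finset.range k, ENNReal.ofReal (1 / k) *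
        ENNReal.ofReal (1 / √(1 + 2 * b * gramianForm a k w)) ^ n := by
        refine Finset.sum_le_sum fun i _ => ?_
        rw [lintegral_const_mul _ (by have := hSm i; fun_prop)]
        gcongr
        exact h.lintegral_exp_neg_stride_le a k i n w hb
    _ = _ := by
        rw [Finset.sum_const, Finset.card_range, nsmul_eq_mul, ← mul_assoc,
          ← ENNReal.ofReal_natCast, ← ENNReal.ofReal_mul hk0.le, mul_one_div_cancel hk0.ne',
          ENNReal.ofReal_one, one_mul]

/-- The exponential (super)martingale of the noise–state cross term `∑ ⟪v, η_t⟫ ⟪w, X_t⟫`. -/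
theorem IsStdGaussianNoise.lintegral_exp_cross_le_one (h : IsStdGaussianNoise η μ) (T : ℕ)
    (v w : E) :
    ∫⁻ ω, ENNReal.ofReal (Real.exp
      (∑ t ∈ Finset.Icc 1 T, ⟪v, η t ω⟫ * ⟪w, linearResponse a η 0 t ω⟫
        - ‖v‖ ^ 2 / 2 * covForm (fun t => linearResponse a η 0 t ω) T w)) ∂μ ≤ 1 := by
  induction T with
  | zero => simp [covForm]
  | succ T ih =>
    refine le_trans (le_of_eq ?_) ih
    have hIcc : ∀ f : ℕ → ℝ, ∑ t ∈ Finset.Icc 1 (T + 1), f t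
        = ∑ t ∈ Finset.Icc 1 T, f t + f (T + 1) := fun f =>
      Finset.sum_Icc_succ_top (by lia) f
    have hm : ∀ t ≤ T + 1, Measurable[noiseSigma η (Set.Iio (T + 1))]
        fun ω => ⟪w, linearResponse a η 0 t ω⟫ := fun t ht =>
      (Continuous.measurable (by fun_prop : Continuous fun x => ⟪w, x⟫)).comp
        ((measurable_linearResponse a 0 t).mono
          (noiseSigma_mono fun i hi => by
            simp only [Set.mem_Ico, Set.mem_Iio] at hi ⊢; lia) le_rfl)
    have hη : ∀ t < T + 1, Measurable[noiseSigma η (Set.Iio (T + 1))] fun ω => ⟪v, η t ω⟫ :=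
      fun t ht => (Continuous.measurable (by fun_prop : Continuous fun x => ⟪v, x⟫)).comp
        (measurable_noiseSigma ht)
    have hU : Measurable[noiseSigma η (Set.Iio (T + 1))] fun ω =>
        ((∑ t ∈ Finset.Icc 1 T, ⟪v, η t ω⟫ * ⟪w, linearResponse a η 0 t ω⟫
          - ‖v‖ ^ 2 / 2 * covForm (fun t => linearResponse a η 0 t ω) T w),
          ⟪w, linearResponse a η 0 (T + 1) ω⟫) := by
      refine Measurable.prodMk (Measurable.sub ?_ (Measurable.const_mul ?_ _)) (hm _ le_rfl)
      · refine Finset.measurable_fun_sum _ fun t ht => ?_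
        have := (Finset.mem_Icc.1 ht).2
        exact (hη t (by lia)).mul (hm t (by lia))
      · refine Finset.measurable_fun_sum _ fun t ht => ?_
        have := (Finset.mem_Icc.1 ht).2
        exact (hm t (by lia)).pow_const 2
    have hY : Measurable[noiseSigma η {T + 1}] fun ω => ⟪v, η (T + 1) ω⟫ :=
      (Continuous.measurable (by fun_prop : Continuous fun x => ⟪v, x⟫)).comp
        (measurable_noiseSigma rfl)
    have hind := h.indepFun (S := Set.Iio (T + 1)) (S' := {T + 1}) (by simp) hU hY
    have key := hind.lintegral_prodMk (hU.mono (h.noiseSigma_le _) le_rfl)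
      (hY.mono (h.noiseSigma_le _) le_rfl)
      (F := fun p => ENNReal.ofReal (Real.exp (p.1.1 - ‖v‖ ^ 2 / 2 * p.1.2 ^ 2)) *
        ENNReal.ofReal (Real.exp (p.1.2 * p.2))) (by fun_prop)
    rw [h.map_inner] at key
    have e1 : ∀ ω, ENNReal.ofReal (Real.exp
        (∑ t ∈ Finset.Icc 1 (T + 1), ⟪v, η t ω⟫ * ⟪w, linearResponse a η 0 t ω⟫
        - ‖v‖ ^ 2 / 2 * covForm (fun t => linearResponse a η 0 t ω) (T + 1) w)) = _ := fun ω => by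
      rw [covForm, hIcc, hIcc, ← covForm, show ∀ A B C D F : ℝ,
        A + B * C - D * (F + C ^ 2) = (A - D * F - D * C ^ 2) + C * B by intros; ring,
        Real.exp_add, ENNReal.ofReal_mul (Real.exp_pos _).le]
    simp only [e1]
    refine key.trans (lintegral_congr fun ω => ?_)
    simp only
    rw [lintegral_const_mul _ (by fun_prop), lintegral_exp_gaussianReal,
      ← ENNReal.ofReal_mul (Real.exp_pos _).le, ← Real.exp_add]
    congr 2
    push_cast
    ring

end Noise

/-! ### Exceptional events -/

/-- Markov's inequality for an integral over an auxiliary parameter (the method of mixtures). -/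
theorem measure_le_lintegral_mixture_le {Ω V : Type*} [MeasurableSpace Ω] [MeasurableSpace V]
    {μ : Measure Ω} [SFinite μ] {ν : Measure V} [SFinite ν] {F : Ω → V → ENNReal}
    (hF : Measurable (Function.uncurry F)) {B : V → ENNReal}
    (hB : ∀ᵐ v ∂ν, ∫⁻ ω, F ω v ∂μ ≤ B v) {ε : ENNReal} (h0 : ε ≠ 0) (ht : ε ≠ ⊤) :
    μ {ω | ε ≤ ∫⁻ v, F ω v ∂ν} ≤ (∫⁻ v, B v ∂ν) / ε := by
  have hm : Measurable fun ω => ∫⁻ v, F ω v ∂ν := hF.lintegral_prod_right'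
  refine (meas_ge_le_lintegral_div hm.aemeasurable h0 ht).trans ?_
  gcongr
  rw [lintegral_lintegral_swap hF.aemeasurable]
  exact lintegral_mono_ae hB

section Events

set_option linter.unusedSectionVars false

variable {E : Type*} [NormedAddCommGroup E] [InnerProductSpace ℝ E] [FiniteDimensional ℝ E]
  [MeasurableSpace E] [BorelSpace E] {Ω : Type*} [MeasurableSpace Ω]

open scoped RealInnerProductSpace

theorem covForm_add_le (x : ℕ → E) (T : ℕ) (u z : E) :
    covForm x T (u + z) ≤ 2 * covForm x T u + 2 * covForm x T z := by
  simp only [covForm, Finset.mul_sum, ← Finset.sum_add_distrib]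
  refine Finset.sum_le_sum fun t _ => ?_
  rw [inner_add_left]
  nlinarith [sq_nonneg (⟪u, x t⟫ - ⟪z, x t⟫)]

theorem covForm_smul (x : ℕ → E) (T : ℕ) (c : ℝ) (u : E) :
    covForm x T (c • u) = c ^ 2 * covForm x T u := by
  simp only [covForm, Finset.mul_sum, inner_smul_left, mul_pow]
  simp

theorem continuous_covForm (x : ℕ → E) (T : ℕ) : Continuous (covForm x T) := by
  unfold covForm; fun_prop

/-- The set of directions of `S` in which the empirical covariance is at most `τ`. -/
def lightDirections (x : ℕ → E) (T : ℕ) (τ : ℝ) (S : Set E) : Set E :=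
  {z ∈ S | covForm x T z ≤ τ}

theorem measurableSet_lightDirections (x : ℕ → E) (T : ℕ) (τ : ℝ) {S : Set E}
    (hS : MeasurableSet S) : MeasurableSet (lightDirections x T τ S) :=
  hS.inter (isClosed_le (continuous_covForm x T) continuous_const).measurableSet

theorem measurableSet_shell (L : E →ₗ[ℝ] E) :
    MeasurableSet {w : E | 1 / 2 ≤ ‖L w‖ ∧ ‖L w‖ ≤ 3 / 2} := by
  have hL : Continuous fun w => ‖L w‖ := L.continuous_of_finiteDimensional.norm
  exact ((isClosed_le continuous_const hL).inter (isClosed_le hL continuous_const)).measurableSet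

/-- Markov's inequality on `S` itself, for Lebesgue measure. -/
theorem half_volume_le_volume_lightDirections (x : ℕ → E) (T : ℕ) {τ : ℝ} (hτ : 0 < τ) {S : Set E}
    (hS : volume S ≠ ⊤)
    (h : ∫⁻ z in S, ENNReal.ofReal (covForm x T z / τ) < volume S / 2) :
    volume S / 2 ≤ volume (lightDirections x T τ S) := by
  have hms : MeasurableSet {z | covForm x T z ≤ τ} :=
    (isClosed_le (continuous_covForm x T) continuous_const).measurableSet
  have h1 : volume (S \ {z | covForm x T z ≤ τ})
      ≤ ∫⁻ z in S, ENNReal.ofReal (covForm x T z / τ) := by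
    have hm : Measurable fun z => ENNReal.ofReal (covForm x T z / τ) := by
      have := (continuous_covForm x T).measurable
      fun_prop
    have := mul_meas_ge_le_lintegral (μ := volume.restrict S) hm 1
    rw [one_mul] at this
    refine le_trans ?_ this
    refine le_trans (measure_mono ?_) (Measure.le_restrict_apply _ _)
    intro z hz
    refine ⟨?_, hz.1⟩
    have : τ < covForm x T z := not_le.1 hz.2
    exact ENNReal.one_le_ofReal.2 ((one_le_div hτ).2 this.le)
  have h2 := measure_inter_add_sdiff (μ := (volume : Measure E)) S hms
  have h3 : volume (S \ {z | covForm x T z ≤ τ}) ≤ volume S / 2 := h1.trans h.le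
  have h4 : volume S ≤ volume (S ∩ {z | covForm x T z ≤ τ}) + volume S / 2 := by
    calc volume S = _ := h2.symm
      _ ≤ _ := by gcongr
  have h5 : volume S / 2 + volume S / 2 ≤ volume (S ∩ {z | covForm x T z ≤ τ}) + volume S / 2 := by
    rwa [ENNReal.add_halves]
  exact (ENNReal.add_le_add_iff_right (ENNReal.div_lt_top hS two_ne_zero).ne).1 h5

variable {η : ℕ → Ω → E} {μ : Measure Ω} [IsProbabilityMeasure μ] (a : E →L[ℝ] E)

theorem IsStdGaussianNoise.measurable_covForm (h : IsStdGaussianNoise η μ) (T : ℕ) :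
    Measurable fun p : Ω × E => covForm (fun t => linearResponse a η 0 t p.1) T p.2 := by
  have hm := h.measurable_response a 0
  unfold covForm
  fun_prop

/-- On average the empirical covariance is at most `T Γ_T`, so with high probability it is not
large on more than half of an ellipsoid of `Γ_T`. -/
theorem IsStdGaussianNoise.measure_heavy_le (h : IsStdGaussianNoise η μ) {T : ℕ} (hT : 1 ≤ T)
    {α r : ℝ} (hα : 0 < α) {S : Set E} (hSm : MeasurableSet S)
    (hS : ∀ z ∈ S, (gramianForm a T z : ℝ) ≤ r ^ 2)
    (h0 : volume S ≠ 0) (ht : volume S ≠ ⊤) :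
    μ {ω | volume S / 2 ≤ ∫⁻ z in S,
        ENNReal.ofReal (covForm (fun t => linearResponse a η 0 t ω) T z / (α * T))}
      ≤ ENNReal.ofReal (2 * r ^ 2 / α) := by
  have hT0 : (0 : ℝ) < T := by exact_mod_cast hT
  have hcov := h.measurable_covForm a T
  have hX := h.measurable_response a 0
  have key := measure_le_lintegral_mixture_le (μ := μ) (ν := volume.restrict S)
    (F := fun ω z => ENNReal.ofReal (covForm (fun t => linearResponse a η 0 t ω) T z / (α * T)))
    (B := fun _ => ENNReal.ofReal (r ^ 2 / α)) (ε := volume S / 2)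
    (by
      simp only [Function.uncurry_def]
      exact ENNReal.measurable_ofReal.comp (hcov.div_const _))
    (by
      filter_upwards [ae_restrict_mem hSm] with z hz
      have e : ∀ ω, ENNReal.ofReal (covForm (fun t => linearResponse a η 0 t ω) T z / (α * T))
          = ENNReal.ofReal (1 / (α * T)) * ∑ t ∈ Finset.Icc 1 T,
            ENNReal.ofReal (⟪z, linearResponse a η 0 t ω⟫ ^ 2) := fun ω => by
        rw [← ENNReal.ofReal_sum_of_nonneg fun _ _ => sq_nonneg _,
          ← ENNReal.ofReal_mul (by positivity), covForm]
        congr 1; ring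
      simp only [e]
      rw [lintegral_const_mul _ (by fun_prop), lintegral_finsetSum _ fun t _ => by fun_prop]
      calc _ ≤ ENNReal.ofReal (1 / (α * T)) * ∑ _t ∈ Finset.Icc 1 T, ENNReal.ofReal (r ^ 2) := by
            gcongr with t ht
            rw [h.lintegral_inner_sq, ← ENNReal.ofReal_coe_nnreal]
            refine ENNReal.ofReal_le_ofReal (le_trans ?_ (hS z hz))
            exact_mod_cast gramianForm_mono a z (Finset.mem_Icc.1 ht).2
        _ = _ := by
            rw [Finset.sum_const, Nat.card_Icc, Nat.add_sub_cancel, nsmul_eq_mul,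
              ← ENNReal.ofReal_natCast, ← ENNReal.ofReal_mul hT0.le,
              ← ENNReal.ofReal_mul (by positivity)]
            congr 1
            field_simp)
    (ENNReal.div_pos h0 (by simp)).ne' (ENNReal.div_lt_top ht two_ne_zero).ne
  refine key.trans (le_of_eq ?_)
  have hs : volume S / (volume S / 2) = 2 := by
    rw [ENNReal.div_eq_inv_mul, ENNReal.inv_div (by simp) (by simp), mul_comm, ← mul_div_assoc,
      mul_comm, mul_div_assoc, ENNReal.div_self h0 ht, mul_one]
  rw [lintegral_const, Measure.restrict_apply_univ, mul_div_assoc, hs,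
    ← ENNReal.ofReal_ofNat 2, ← ENNReal.ofReal_mul (by positivity)]
  congr 1
  ring

/-- If the empirical covariance is small at one point of the unit ellipsoid of `L` and on a large
part of a small ellipsoid, then it is small on a large part of a shell: the mixture of its Laplace
transforms over the shell is large. -/
theorem volume_mul_exp_le_lintegral_shell (x : ℕ → E) (T : ℕ) {τ β : ℝ} (hβ : 0 ≤ β)
    (L : E →ₗ[ℝ] E) {S : Set E} (hSm : MeasurableSet S) (hSL : ∀ z ∈ S, ‖L z‖ ≤ 1 / 2) {u : E} (hu : ‖L u‖ = 1)
    (hq : covForm x T u ≤ τ) :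
    volume (lightDirections x T τ S) * ENNReal.ofReal (Real.exp (-(4 * β * τ)))
      ≤ ∫⁻ w in {w : E | 1 / 2 ≤ ‖L w‖ ∧ ‖L w‖ ≤ 3 / 2},
        ENNReal.ofReal (Real.exp (-β * covForm x T w)) := by
  set Z := lightDirections x T τ S
  have hms : MeasurableSet {w : E | 1 / 2 ≤ ‖L w‖ ∧ ‖L w‖ ≤ 3 / 2} :=
    measurableSet_shell L
  rw [← lintegral_indicator hms, ← lintegral_add_left_eq_self _ u]
  calc _ = ∫⁻ _z in Z, ENNReal.ofReal (Real.exp (-(4 * β * τ))) := by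
        rw [setLIntegral_const, mul_comm]
    _ ≤ ∫⁻ z in Z, ({w : E | 1 / 2 ≤ ‖L w‖ ∧ ‖L w‖ ≤ 3 / 2}.indicator
          (fun w => ENNReal.ofReal (Real.exp (-β * covForm x T w)))) (u + z) := by
        refine setLIntegral_mono' (measurableSet_lightDirections x T τ hSm) fun z hz => ?_
        have h1 := hSL z hz.1
        have h2 : |‖L u‖ - ‖L z‖| ≤ ‖L (u + z)‖ := by
          rw [map_add]
          simpa using abs_norm_sub_norm_le (L u) (-L z)
        have h3 : ‖L (u + z)‖ ≤ ‖L u‖ + ‖L z‖ := by rw [map_add]; exact norm_add_le _ _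
        rw [Set.indicator_of_mem]
        · refine ENNReal.ofReal_le_ofReal (Real.exp_le_exp.2 ?_)
          have := covForm_add_le x T u z
          have h4 := hz.2
          have : covForm x T (u + z) ≤ 4 * τ := by linarith
          nlinarith
        · have := le_abs_self (‖L u‖ - ‖L z‖)
          constructor <;> linarith
    _ ≤ _ := setLIntegral_le_lintegral _ _

/-- With high probability the empirical covariance is not small on too much of a shell of `Γ_k`. -/
theorem IsStdGaussianNoise.measure_shell_le (h : IsStdGaussianNoise η μ) {k n T : ℕ}
    (hk : 1 ≤ k) (hn : k * (n + 1) ≤ T + 1) (L : E →ₗ[ℝ] E)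
    (hL : ∀ w, (gramianForm a k w : ℝ) = ‖L w‖ ^ 2) {ε : ENNReal} (h0 : ε ≠ 0) (ht : ε ≠ ⊤) :
    μ {ω | ε ≤ ∫⁻ w in {w : E | 1 / 2 ≤ ‖L w‖ ∧ ‖L w‖ ≤ 3 / 2}, ENNReal.ofReal (Real.exp
        (-(6 / k) * covForm (fun t => linearResponse a η 0 t ω) T w))}
      ≤ ENNReal.ofReal ((1 / 2) ^ n) * volume {w : E | ‖L w‖ ≤ 3 / 2} / ε := by
  have hcov := h.measurable_covForm a T
  have hms : MeasurableSet {w : E | 1 / 2 ≤ ‖L w‖ ∧ ‖L w‖ ≤ 3 / 2} :=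
    measurableSet_shell L
  refine (measure_le_lintegral_mixture_le (μ := μ)
    (ν := volume.restrict {w : E | 1 / 2 ≤ ‖L w‖ ∧ ‖L w‖ ≤ 3 / 2})
    (F := fun ω w => ENNReal.ofReal (Real.exp
        (-(6 / k) * covForm (fun t => linearResponse a η 0 t ω) T w)))
    (B := fun _ => ENNReal.ofReal ((1 / 2) ^ n))
    (by
      simp only [Function.uncurry_def]
      exact ENNReal.measurable_ofReal.comp (Real.measurable_exp.comp (hcov.const_mul _)))
    ?_ h0 ht).trans ?_
  · filter_upwards [ae_restrict_mem hms] with w hw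
    refine (h.lintegral_exp_neg_covForm_le a hk hn w (b := 6) (by norm_num)).trans ?_
    rw [ENNReal.ofReal_pow (by norm_num)]
    gcongr
    rw [hL]
    have h1 : (2 : ℝ) ≤ √(1 + 2 * 6 * ‖L w‖ ^ 2) := by
      refine Real.le_sqrt_of_sq_le ?_
      have := hw.1
      nlinarith
    exact h1
  · rw [setLIntegral_const]
    gcongr
    exact fun hw => hw.2

/-- The normal equations `D ∑ x_t x_tᵀ = ∑ e_t x_tᵀ` for the estimation error `D = Â - A` of least
squares on the trajectory `x` driven by the noise `e`, written in bilinear form so that no inverse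
of the empirical covariance is needed. -/
def NormalEquations (x e : ℕ → E) (T : ℕ) (D : E →L[ℝ] E) : Prop :=
  ∀ v w : E, ∑ t ∈ Finset.Icc 1 T, ⟪v, e t⟫ * ⟪w, x t⟫
    = ∑ t ∈ Finset.Icc 1 T, ⟪v, D (x t)⟫ * ⟪w, x t⟫

/-- A large estimation error makes the exponential cross term large along the shift `w = D*v / (8κ) + z`:
completing the square there leaves the gain `covForm (D*v) / 16`. -/
theorem NormalEquations.le_cross {x e : ℕ → E} {T : ℕ} {D : E →L[ℝ] E} (hD : NormalEquations x e T D)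
    {κ : ℝ} (hκ : 0 < κ) (v z : E) :
    covForm x T (D.adjoint v) / 16 - 4 * κ ^ 2 * covForm x T z
      = ∑ t ∈ Finset.Icc 1 T, ⟪v, e t⟫ * ⟪κ • ((1 / (8 * κ)) • D.adjoint v + z), x t⟫
        - 4 * covForm x T (κ • ((1 / (8 * κ)) • D.adjoint v + z)) := by
  rw [hD]
  simp only [covForm, Finset.mul_sum, Finset.sum_div, ← Finset.sum_sub_distrib]
  refine Finset.sum_congr rfl fun t _ => ?_
  rw [← ContinuousLinearMap.adjoint_inner_left]
  simp only [inner_smul_left, inner_add_left, RCLike.conj_to_real]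
  field_simp
  ring

/-- The exponential cross term, mixed over `v` uniform on a ball and `w` Gaussian with precision the
Gramian form `‖L w‖²`, is unlikely to exceed its mean by much. -/
theorem IsStdGaussianNoise.measure_cross_le (h : IsStdGaussianNoise η μ) (T : ℕ) (κ : ℝ)
    (L : E →ₗ[ℝ] E) {ε : ENNReal} (h0 : ε ≠ 0) (ht : ε ≠ ⊤) :
    μ {ω | ε ≤ ∫⁻ p : E × E, ENNReal.ofReal (Real.exp
        (∑ t ∈ Finset.Icc 1 T, ⟪p.1, η t ω⟫ * ⟪κ • p.2, linearResponse a η 0 t ω⟫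
        - ‖p.1‖ ^ 2 / 2 * covForm (fun t => linearResponse a η 0 t ω) T (κ • p.2))) *
        ENNReal.ofReal (Real.exp (-‖L p.2‖ ^ 2 / 2))
        ∂((volume.restrict (Metric.ball (0 : E) 2)).prod volume)}
      ≤ volume (Metric.ball (0 : E) 2) *
        (∫⁻ w : E, ENNReal.ofReal (Real.exp (-‖L w‖ ^ 2 / 2))) / ε := by
  have hX := h.measurable_response a 0
  have hη := h.measurable
  have hLm : Measurable L := L.continuous_of_finiteDimensional.measurable
  refine (measure_le_lintegral_mixture_le (μ := μ)
    (ν := (volume.restrict (Metric.ball (0 : E) 2)).prod volume)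
    (F := fun ω p => ENNReal.ofReal (Real.exp
        (∑ t ∈ Finset.Icc 1 T, ⟪p.1, η t ω⟫ * ⟪κ • p.2, linearResponse a η 0 t ω⟫
        - ‖p.1‖ ^ 2 / 2 * covForm (fun t => linearResponse a η 0 t ω) T (κ • p.2))) *
        ENNReal.ofReal (Real.exp (-‖L p.2‖ ^ 2 / 2)))
    (B := fun p => ENNReal.ofReal (Real.exp (-‖L p.2‖ ^ 2 / 2)))
    (by simp only [Function.uncurry_def, covForm]; fun_prop)
    (ae_of_all _ fun p => ?_) h0 ht).trans ?_
  · rw [lintegral_mul_const _ (by unfold covForm; fun_prop)]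
    exact mul_le_of_le_one_left' (h.lintegral_exp_cross_le_one a T p.1 (κ • p.2))
  · gcongr
    have := lintegral_prod_mul (μ := volume.restrict (Metric.ball (0 : E) 2))
      (ν := (volume : Measure E)) (f := fun _ => (1 : ENNReal))
      (g := fun w => ENNReal.ofReal (Real.exp (-‖L w‖ ^ 2 / 2))) (by fun_prop) (by fun_prop)
    simp only [one_mul, lintegral_const, Measure.restrict_apply_univ] at this
    exact this.le

/-- If the empirical covariance dominates `τ ‖L ·‖²` and is at most `τ` on many directions of `S`,
then an estimation error of norm more than `m` makes the mixed cross term large. The scale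
`κ = 1 / (2 √τ)` is the one at which both the Gaussian weight and the shift by a direction of `S`
cost a bounded amount in the exponent. -/
theorem NormalEquations.volume_mul_exp_le {x e : ℕ → E} {T : ℕ} {D : E →L[ℝ] E}
    (hD : NormalEquations x e T D) {τ l m : ℝ} (hτ : 0 < τ) (hl : 0 ≤ l) (hm : 0 ≤ m)
    (hDm : m < ‖D‖) (L : E →ₗ[ℝ] E) (hl' : ∀ w, l * ‖w‖ ^ 2 ≤ ‖L w‖ ^ 2)
    (hq : ∀ w, τ * ‖L w‖ ^ 2 ≤ covForm x T w) {S : Set E} (hSm : MeasurableSet S) :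
    volume (Metric.ball (0 : E) (1 / 4)) * (volume (lightDirections x T τ S) *
      ENNReal.ofReal (Real.exp (τ * l * m ^ 2 / 64 - 1)))
      ≤ ∫⁻ p : E × E, ENNReal.ofReal (Real.exp
        (∑ t ∈ Finset.Icc 1 T, ⟪p.1, e t⟫ * ⟪(1 / (2 * √τ)) • p.2, x t⟫
        - ‖p.1‖ ^ 2 / 2 * covForm x T ((1 / (2 * √τ)) • p.2))) *
        ENNReal.ofReal (Real.exp (-‖L p.2‖ ^ 2 / 2))
        ∂((volume.restrict (Metric.ball (0 : E) 2)).prod volume) := by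
  set κ : ℝ := 1 / (2 * √τ) with hκ
  have hsτ : 0 < √τ := Real.sqrt_pos.2 hτ
  have hκ0 : 0 < κ := by positivity
  have hκτ : 4 * κ ^ 2 * τ = 1 := by
    rw [hκ, div_pow, mul_pow, Real.sq_sqrt hτ.le]; field_simp; norm_num
  have hLm : Measurable L := L.continuous_of_finiteDimensional.measurable
  -- a near-maximiser of `‖D* v‖` over the unit ball
  obtain ⟨v₀, hv₀, hv₀'⟩ := ContinuousLinearMap.exists_lt_apply_of_lt_opNorm D.adjoint
    (show max m (3 / 4 * ‖D‖) < ‖D.adjoint‖ by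
      rw [LinearIsometryEquiv.norm_map]
      exact max_lt hDm (by linarith))
  have hv : ∀ v ∈ Metric.ball v₀ (1 / 4), m / 2 ≤ ‖D.adjoint v‖ ∧ ‖v‖ < 2 := by
    intro v hv
    rw [mem_ball_iff_norm] at hv
    have h1 : ‖D.adjoint (v - v₀)‖ ≤ ‖D‖ * (1 / 4) := by
      refine (D.adjoint.le_opNorm _).trans ?_
      rw [LinearIsometryEquiv.norm_map]
      gcongr
    have h2 : ‖D.adjoint v₀‖ ≤ ‖D.adjoint v‖ + ‖D.adjoint (v - v₀)‖ := by
      rw [map_sub]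
      simpa using norm_sub_le (D.adjoint v) (D.adjoint v - D.adjoint v₀)
    have h3 := le_max_left m (3 / 4 * ‖D‖)
    have h4 := le_max_right m (3 / 4 * ‖D‖)
    refine ⟨by linarith, ?_⟩
    have : ‖v‖ ≤ ‖v₀‖ + ‖v - v₀‖ := by simpa using norm_add_le v₀ (v - v₀)
    linarith
  have hpt : ∀ v ∈ Metric.ball v₀ (1 / 4), ∀ z ∈ lightDirections x T τ S,
      ENNReal.ofReal (Real.exp (τ * l * m ^ 2 / 64 - 1)) ≤
      ENNReal.ofReal (Real.exp
        (∑ t ∈ Finset.Icc 1 T, ⟪v, e t⟫ * ⟪κ • ((1 / (8 * κ)) • D.adjoint v + z), x t⟫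
        - ‖v‖ ^ 2 / 2 * covForm x T (κ • ((1 / (8 * κ)) • D.adjoint v + z)))) *
        ENNReal.ofReal (Real.exp (-‖L ((1 / (8 * κ)) • D.adjoint v + z)‖ ^ 2 / 2)) := by
    intro v hvb z hz
    obtain ⟨h1, h2⟩ := hv v hvb
    have h3 := hD.le_cross hκ0 v z
    set w := (1 / (8 * κ)) • D.adjoint v + z with hw
    rw [← ENNReal.ofReal_mul (Real.exp_pos _).le, ← Real.exp_add]
    refine ENNReal.ofReal_le_ofReal (Real.exp_le_exp.2 ?_)
    have hcw := covForm_smul x T κ w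
    have hcw0 := covForm_nonneg x T (κ • w)
    -- the Gaussian weight costs no more than half of the quadratic term
    have h4 : ‖L w‖ ^ 2 / 2 ≤ 2 * covForm x T (κ • w) := by
      have h5 := hq w
      rw [hcw]
      have : ‖L w‖ ^ 2 = 4 * κ ^ 2 * (τ * ‖L w‖ ^ 2) := by
        rw [← mul_assoc, hκτ, one_mul]
      rw [this]
      nlinarith [sq_nonneg κ]
    have h6 : ‖v‖ ^ 2 / 2 * covForm x T (κ • w) ≤ 2 * covForm x T (κ • w) := by
      have : ‖v‖ ^ 2 ≤ 4 := by nlinarith [norm_nonneg v]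
      nlinarith
    have h7 : 4 * κ ^ 2 * covForm x T z ≤ 1 := by
      rw [← hκτ]; exact mul_le_mul_of_nonneg_left hz.2 (by positivity)
    have h8 : τ * l * m ^ 2 / 64 ≤ covForm x T (D.adjoint v) / 16 := by
      have e1 := hq (D.adjoint v)
      have e2 := mul_le_mul_of_nonneg_left (hl' (D.adjoint v)) hτ.le
      have e3 : m ^ 2 / 4 ≤ ‖D.adjoint v‖ ^ 2 := by nlinarith
      have e4 := mul_le_mul_of_nonneg_left e3 (mul_nonneg hτ.le hl)
      nlinarith
    linarith
  have hmeas : Measurable fun p : E × E => ENNReal.ofReal (Real.exp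
        (∑ t ∈ Finset.Icc 1 T, ⟪p.1, e t⟫ * ⟪κ • p.2, x t⟫
        - ‖p.1‖ ^ 2 / 2 * covForm x T (κ • p.2))) *
        ENNReal.ofReal (Real.exp (-‖L p.2‖ ^ 2 / 2)) := by
    unfold covForm; fun_prop
  rw [lintegral_prod _ hmeas.aemeasurable]
  calc _ = ∫⁻ _v in Metric.ball v₀ (1 / 4), volume (lightDirections x T τ S) *
        ENNReal.ofReal (Real.exp (τ * l * m ^ 2 / 64 - 1)) := by
        rw [setLIntegral_const, mul_comm, Measure.addHaar_ball_center volume v₀]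
    _ ≤ ∫⁻ v in Metric.ball v₀ (1 / 4), ∫⁻ w, ENNReal.ofReal (Real.exp
        (∑ t ∈ Finset.Icc 1 T, ⟪v, e t⟫ * ⟪κ • w, x t⟫
        - ‖v‖ ^ 2 / 2 * covForm x T (κ • w))) *
        ENNReal.ofReal (Real.exp (-‖L w‖ ^ 2 / 2)) := by
        refine setLIntegral_mono' measurableSet_ball fun v hvb => ?_
        rw [← lintegral_add_left_eq_self _ ((1 / (8 * κ)) • D.adjoint v), mul_comm,
          ← setLIntegral_const]
        exact (setLIntegral_mono' (measurableSet_lightDirections x T τ hSm) fun z hz => hpt v hvb z hz).trans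
          (setLIntegral_le_lintegral _ _)
    _ ≤ _ := lintegral_mono_set fun v hvb => mem_ball_zero_iff.2 (hv v hvb).2

end Events

/-! ### The deviation bound for standard Gaussian noise -/

section Deviation

set_option linter.unusedSectionVars false

variable {E : Type*} [NormedAddCommGroup E] [InnerProductSpace ℝ E] [FiniteDimensional ℝ E]
  [MeasurableSpace E] [BorelSpace E] {Ω : Type*} [MeasurableSpace Ω]
  {η : ℕ → Ω → E} {μ : Measure Ω} [IsProbabilityMeasure μ] (a : E →L[ℝ] E)

/-- A large estimation error forces one of the three exceptional events. -/
theorem IsStdGaussianNoise.measure_normalEquations_le (h : IsStdGaussianNoise η μ) {k n T : ℕ}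
    (hk : 1 ≤ k) (hT : 1 ≤ T) (hn : k * (n + 1) ≤ T + 1) {L M : E →ₗ[ℝ] E}
    (hMdet : LinearMap.det M ≠ 0)
    (hL : ∀ w, (gramianForm a k w : ℝ) = ‖L w‖ ^ 2) (hM : ∀ w, (gramianForm a T w : ℝ) = ‖M w‖ ^ 2)
    (hLM : ∀ w, ‖L w‖ ≤ ‖M w‖) {l : ℝ} (hl : 0 ≤ l) (hl' : ∀ w, l * ‖w‖ ^ 2 ≤ ‖L w‖ ^ 2)
    {α r m : ℝ} (hα : 0 < α) (hr : 0 < r) (hr' : r ≤ 1 / 2) (hm : 0 ≤ m) :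
    μ {ω | ∃ D, NormalEquations (fun t => linearResponse a η 0 t ω) (fun t => η t ω) T D ∧ m < ‖D‖}
      ≤ ENNReal.ofReal (2 * r ^ 2 / α)
        + ENNReal.ofReal ((1 / 2) ^ n) * volume {w : E | ‖L w‖ ≤ 3 / 2} /
          (volume {z : E | ‖M z‖ ≤ r} / 2 * ENNReal.ofReal (Real.exp (-(4 * (6 / k) * (α * T)))))
        + volume (Metric.ball (0 : E) 2) *
          (∫⁻ w : E, ENNReal.ofReal (Real.exp (-‖L w‖ ^ 2 / 2))) /
          (volume (Metric.ball (0 : E) (1 / 4)) * (volume {z : E | ‖M z‖ ≤ r} / 2 *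
            ENNReal.ofReal (Real.exp (α * T * l * m ^ 2 / 64 - 1)))) := by
  have hT0 : (0 : ℝ) < T := by exact_mod_cast hT
  have hτ : 0 < α * T := by positivity
  set S : Set E := {z : E | ‖M z‖ ≤ r} with hS
  have hMc : Continuous fun z => ‖M z‖ := M.continuous_of_finiteDimensional.norm
  have hSm : MeasurableSet S := (isClosed_le hMc continuous_const).measurableSet
  have hb0 : ∀ s : ℝ, 0 < s → volume (Metric.ball (0 : E) s) ≠ 0 := fun s hs =>
    (Metric.measure_ball_pos volume (0 : E) hs).ne'
  have hbt : ∀ s : ℝ, volume (Metric.ball (0 : E) s) ≠ ⊤ := fun s => measure_ball_lt_top.ne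
  have hSvol := volume_setOf_norm_linearMap_le M hMdet hr.le
  have hS0 : volume S ≠ 0 := by
    rw [hSvol]
    refine mul_ne_zero ?_ (hb0 1 one_pos)
    have : 0 < |(LinearMap.det M)⁻¹| := abs_pos.2 (inv_ne_zero hMdet)
    exact (ENNReal.ofReal_pos.2 (by positivity)).ne'
  have hSt : volume S ≠ ⊤ := by
    rw [hSvol]; exact ENNReal.mul_ne_top ENNReal.ofReal_ne_top (hbt 1)
  have hS20 : volume S / 2 ≠ 0 := (ENNReal.div_pos hS0 (by simp)).ne'
  have hS2t : volume S / 2 ≠ ⊤ := (ENNReal.div_lt_top hSt two_ne_zero).ne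
  have he0 : ∀ s : ℝ, ENNReal.ofReal (Real.exp s) ≠ 0 := fun s =>
    (ENNReal.ofReal_pos.2 (Real.exp_pos s)).ne'
  have h1 := h.measure_heavy_le a hT (α := α) (r := r) hα hSm
    (fun z hz => by rw [hM]; exact pow_le_pow_left₀ (norm_nonneg _) hz 2) hS0 hSt
  have h2 := h.measure_shell_le a hk hn L hL
    (ε := volume S / 2 * ENNReal.ofReal (Real.exp (-(4 * (6 / k) * (α * T)))))
    (mul_ne_zero hS20 (he0 _)) (ENNReal.mul_ne_top hS2t ENNReal.ofReal_ne_top)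
  have h3 := h.measure_cross_le a T (1 / (2 * √(α * T))) L
    (ε := volume (Metric.ball (0 : E) (1 / 4)) * (volume S / 2 *
            ENNReal.ofReal (Real.exp (α * T * l * m ^ 2 / 64 - 1))))
    (mul_ne_zero (hb0 _ (by norm_num)) (mul_ne_zero hS20 (he0 _)))
    (ENNReal.mul_ne_top (hbt _) (ENNReal.mul_ne_top hS2t ENNReal.ofReal_ne_top))
  refine le_trans (measure_mono ?_) ((measure_union_le _ _).trans (add_le_add
    ((measure_union_le _ _).trans (add_le_add h1 h2)) h3))
  rintro ω ⟨D, hD, hDm⟩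
  by_contra hω
  simp only [Set.mem_union, not_or, Set.mem_ofPred_eq] at hω
  obtain ⟨⟨hω1, hω2⟩, hω3⟩ := hω
  have hZ := half_volume_le_volume_lightDirections (fun t => linearResponse a η 0 t ω) T hτ hSt
    (not_le.1 hω1)
  have hq : ∀ w, α * T * ‖L w‖ ^ 2 ≤ covForm (fun t => linearResponse a η 0 t ω) T w := by
    intro w
    by_cases hw : L w = 0
    · simpa [hw] using covForm_nonneg _ T w
    have hw' : 0 < ‖L w‖ := norm_pos_iff.2 hw
    by_contra hlt
    rw [not_le] at hlt
    refine hω2 (le_trans ?_ (volume_mul_exp_le_lintegral_shell (fun t => linearResponse a η 0 t ω) T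
      (β := 6 / k) (by positivity) L hSm
      (fun z hz => (hLM z).trans (le_trans hz hr')) (u := ‖L w‖⁻¹ • w) ?_ ?_ (τ := α * T)))
    · gcongr
    · rw [map_smul, norm_smul, norm_inv, norm_norm, inv_mul_cancel₀ hw'.ne']
    · rw [covForm_smul, inv_pow, inv_mul_le_iff₀ (by positivity)]
      linarith
  refine hω3 (le_trans ?_ (hD.volume_mul_exp_le hτ hl hm hDm L hl' hq hSm))
  gcongr

end Deviation

/-- All quantities that depend on the dimension and the confidence level only are bounded by powers
of `(d / δ) ^ d = exp (d log (d / δ))`. -/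
theorem dimension_bounds {d : ℕ} (hd : 1 ≤ d) {δ : ℝ} (hδ : 0 < δ) (hδ' : δ < 1 / 2) :
    2 ^ d ≤ (d / δ) ^ d ∧ (d : ℝ) ^ d ≤ (d / δ) ^ d ∧
      1 / δ ≤ (d / δ) ^ d ∧ 2 ≤ (d / δ) ^ d ∧ (1 / √(δ / 6000)) ^ d ≤ ((d / δ) ^ d) ^ 8 := by
  have hd0 : (1 : ℝ) ≤ d := by exact_mod_cast hd
  have h2 : (2 : ℝ) ≤ d / δ := (le_div_iff₀ hδ).2 (by linarith)
  have h1δ : 1 / δ ≤ d / δ := by gcongr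
  have hone : 1 ≤ 1 / δ := (one_le_div hδ).2 (by linarith)
  have hdδ : (d : ℝ) ≤ d / δ := (le_div_iff₀ hδ).2 (by nlinarith)
  have b1 : (2 : ℝ) ^ d ≤ (d / δ) ^ d := by gcongr
  have b2 : (1 / δ) ^ d ≤ (d / δ) ^ d := by gcongr
  refine ⟨b1, by gcongr, (le_self_pow₀ hone (by lia)).trans b2,
    (le_self_pow₀ (by norm_num) (by lia)).trans b1, ?_⟩
  have hr : δ / 128 ≤ √(δ / 6000) := Real.le_sqrt_of_sq_le (by nlinarith)
  have hr' : 1 / √(δ / 6000) ≤ 2 ^ 7 * (1 / δ) := by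
    calc 1 / √(δ / 6000) ≤ 1 / (δ / 128) := one_div_le_one_div_of_le (by positivity) hr
      _ = _ := by field_simp; norm_num
  calc (1 / √(δ / 6000)) ^ d ≤ (2 ^ 7 * (1 / δ)) ^ d := by gcongr
    _ = (2 ^ d) ^ 7 * (1 / δ) ^ d := by rw [mul_pow, ← pow_mul, ← pow_mul, mul_comm 7 d]
    _ ≤ ((d / δ) ^ d) ^ 7 * (d / δ) ^ d := by gcongr
    _ = _ := by ring

theorem exp_complexity {d : ℕ} (hd : 1 ≤ d) {δ ρ K : ℝ} (hδ : 0 < δ) (hρ : 1 ≤ ρ)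
    (hK : K = d * Real.log (d / δ) + 2 * Real.log ρ) : Real.exp K = (d / δ) ^ d * ρ ^ 2 := by
  have hd0 : (1 : ℝ) ≤ d := by exact_mod_cast hd
  have h : 0 < d / δ := by positivity
  have hρ0 : 0 < ρ := by linarith
  rw [hK, Real.exp_add, Real.exp_nat_mul, Real.exp_log h, show (2 : ℝ) = (2 : ℕ) by norm_num,
    Real.exp_nat_mul, Real.exp_log hρ0]

/-- The failure probability of the small-ball event is absorbed by the burn-in condition. -/
theorem small_ball_term_le {d : ℕ} (hd : 1 ≤ d) {δ ρ K τ : ℝ} {n : ℕ} (hδ : 0 < δ) (hδ' : δ < 1 / 2)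
    (hρ : 1 ≤ ρ) (hK : K = d * Real.log (d / δ) + 2 * Real.log ρ) (hτ : 30 * K ≤ τ)
    (hn : τ ≤ n + 2) :
    (1 / 2) ^ n * (ρ * (3 / 2) ^ d) / ((√(δ / 6000)) ^ d / 2 * Real.exp (-(24 / 1000 * τ)))
      ≤ δ / 3 := by
  obtain ⟨b1, -, b4, b5, b6⟩ := dimension_bounds hd hδ hδ'
  have hexp := exp_complexity hd hδ hρ hK
  set y := ((d : ℝ) / δ) ^ d
  have hr0 : 0 < √(δ / 6000) := Real.sqrt_pos.2 (by positivity)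
  set r := √(δ / 6000)
  have hK0 : 0 ≤ K := by
    rw [← Real.one_le_exp_iff, hexp]
    nlinarith [one_le_pow₀ (n := 2) hρ]
  have hlog := Real.log_two_gt_d9
  -- `log 2 - 24 / 1000 ≥ 1 / 2`, and the two missing blocks cost a factor `4`
  have hpow : (1 / 2 : ℝ) ^ n * Real.exp (24 / 1000 * τ) ≤ 4 * Real.exp (-(15 * K)) := by
    have e1 : (1 / 2 : ℝ) ^ n = Real.exp (-(n * Real.log 2)) := by
      rw [Real.exp_neg, Real.exp_nat_mul, Real.exp_log two_pos, one_div, inv_pow]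
    have e2 : (4 : ℝ) = Real.exp (2 * Real.log 2) := by
      rw [show (2 : ℝ) * Real.log 2 = (2 : ℕ) * Real.log 2 by norm_num, Real.exp_nat_mul,
        Real.exp_log two_pos]
      norm_num
    rw [e1, e2, ← Real.exp_add, ← Real.exp_add, Real.exp_le_exp]
    nlinarith
  have h15 : Real.exp (-(15 * K)) = 1 / (y * ρ ^ 2) ^ 15 := by
    rw [Real.exp_neg, show (15 : ℝ) * K = (15 : ℕ) * K by norm_num, Real.exp_nat_mul, hexp, one_div]
  have e3 : (1 / 2) ^ n * (ρ * (3 / 2) ^ d) / (r ^ d / 2 * Real.exp (-(24 / 1000 * τ)))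
      = 2 * ρ * (3 / 2) ^ d * (1 / r) ^ d * ((1 / 2 : ℝ) ^ n * Real.exp (24 / 1000 * τ)) := by
    rw [Real.exp_neg, one_div_pow r d]
    have := Real.exp_pos (24 / 1000 * τ)
    field_simp
  have b7 : (3 / 2 : ℝ) ^ d ≤ y := le_trans (by gcongr; norm_num) b1
  have hy0 : 0 < y := by linarith
  rw [e3]
  calc 2 * ρ * (3 / 2) ^ d * (1 / r) ^ d * ((1 / 2 : ℝ) ^ n * Real.exp (24 / 1000 * τ))
      ≤ 2 * ρ * y * y ^ 8 * (4 * (1 / (y * ρ ^ 2) ^ 15)) := by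
        rw [← h15]; gcongr
    _ ≤ δ / 3 := by
        rw [show 2 * ρ * y * y ^ 8 * (4 * (1 / (y * ρ ^ 2) ^ 15))
          = 8 * ρ * y ^ 9 / (y * ρ ^ 2) ^ 15 by ring, div_le_iff₀ (by positivity)]
        have hyδ : 1 ≤ y * δ := by rwa [div_le_iff₀ hδ] at b4
        calc 8 * ρ * y ^ 9 ≤ (32 / 3) * ρ ^ 30 * y ^ 9 * (y * δ) := by
              have h1 : ρ ≤ ρ ^ 30 := le_self_pow₀ hρ (by norm_num)
              calc 8 * ρ * y ^ 9 ≤ (32 / 3) * ρ ^ 30 * y ^ 9 * 1 := by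
                    rw [mul_one]; gcongr; norm_num
                _ ≤ _ := by gcongr
          _ = δ / 3 * (2 ^ 5 * y ^ 10 * ρ ^ 30) := by ring
          _ ≤ δ / 3 * (y ^ 5 * y ^ 10 * ρ ^ 30) := by gcongr
          _ = _ := by ring

/-- The failure probability of the cross-term event at the claimed error level. -/
theorem cross_term_le {d : ℕ} (hd : 1 ≤ d) {δ ρ K Θ : ℝ} (hδ : 0 < δ) (hδ' : δ < 1 / 2)
    (hρ : 1 ≤ ρ) (hK : K = d * Real.log (d / δ) + 2 * Real.log ρ) (hΘ : 19 * K ≤ Θ) :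
    2 ^ d * (ρ * √(2 * Real.pi) ^ d) / ((1 / 4) ^ d * (√(δ / 6000) ^ d *
      (√Real.pi ^ d / Real.Gamma ((d : ℝ) / 2 + 1)) / 2 * Real.exp (Θ - 1))) ≤ δ / 3 := by
  obtain ⟨b1, b2, b4, b5, b6⟩ := dimension_bounds hd hδ hδ'
  have hexp := exp_complexity hd hδ hρ hK
  have bG := gamma_half_add_one_le d hd
  have hG : 0 < Real.Gamma ((d : ℝ) / 2 + 1) := Real.Gamma_pos_of_pos (by positivity)
  set G := Real.Gamma ((d : ℝ) / 2 + 1)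
  set y := ((d : ℝ) / δ) ^ d
  have hr0 : 0 < √(δ / 6000) := Real.sqrt_pos.2 (by positivity)
  set r := √(δ / 6000)
  have hy0 : 0 < y := by linarith
  have hπ : 0 < √Real.pi := Real.sqrt_pos.2 Real.pi_pos
  have h19 : Real.exp (1 - Θ) ≤ 3 * (1 / (y * ρ ^ 2) ^ 19) := by
    have e1 : Real.exp (-(19 * K)) = 1 / (y * ρ ^ 2) ^ 19 := by
      rw [Real.exp_neg, show (19 : ℝ) * K = (19 : ℕ) * K by norm_num, Real.exp_nat_mul, hexp,
        one_div]
    have e2 : Real.exp 1 ≤ 3 := by linarith [Real.exp_one_lt_d9]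
    rw [sub_eq_add_neg, Real.exp_add, ← e1]
    gcongr
  have e3 : 2 ^ d * (ρ * √(2 * Real.pi) ^ d) / ((1 / 4) ^ d * (r ^ d *
      (√Real.pi ^ d / G) / 2 * Real.exp (Θ - 1)))
      = 2 * ρ * 2 ^ d * √2 ^ d * 4 ^ d * (1 / r) ^ d * G * Real.exp (1 - Θ) := by
    rw [show (1 : ℝ) - Θ = -(Θ - 1) by ring, Real.exp_neg, one_div_pow r d, one_div_pow 4 d,
      Real.sqrt_mul (by norm_num), mul_pow]
    have := Real.exp_pos (Θ - 1)
    field_simp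
  have b7 : √2 ^ d ≤ y := by
    refine le_trans ?_ b1
    gcongr
    exact Real.sqrt_le_iff.2 ⟨by norm_num, by norm_num⟩
  have b8 : (4 : ℝ) ^ d ≤ y ^ 2 := by
    rw [show (4 : ℝ) = 2 ^ 2 by norm_num, ← pow_mul, mul_comm 2 d, pow_mul]
    gcongr
  rw [e3]
  calc 2 * ρ * 2 ^ d * √2 ^ d * 4 ^ d * (1 / r) ^ d * G * Real.exp (1 - Θ)
      ≤ 2 * ρ * y * y * y ^ 2 * y ^ 8 * y * (3 * (1 / (y * ρ ^ 2) ^ 19)) := by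
        have := bG.trans b2
        gcongr
    _ ≤ δ / 3 := by
        rw [show 2 * ρ * y * y * y ^ 2 * y ^ 8 * y * (3 * (1 / (y * ρ ^ 2) ^ 19))
          = 6 * ρ * y ^ 13 / (y * ρ ^ 2) ^ 19 by ring, div_le_iff₀ (by positivity)]
        have hyδ : 1 ≤ y * δ := by rwa [div_le_iff₀ hδ] at b4
        calc 6 * ρ * y ^ 13 ≤ (32 / 3) * ρ ^ 38 * y ^ 13 * (y * δ) := by
              have h1 : ρ ≤ ρ ^ 38 := le_self_pow₀ hρ (by norm_num)
              calc 6 * ρ * y ^ 13 ≤ (32 / 3) * ρ ^ 38 * y ^ 13 * 1 := by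
                    rw [mul_one]; gcongr; norm_num
                _ ≤ _ := by gcongr
          _ = δ / 3 * (2 ^ 5 * y ^ 14 * ρ ^ 38) := by ring
          _ ≤ δ / 3 * (y ^ 5 * y ^ 14 * ρ ^ 38) := by gcongr
          _ = _ := by ring

/-- The deviation bound with explicit constants. The covariance level `α = 1 / 1000` makes the
small-ball estimate win by a factor `log 2 - 24 α > 1 / 2` in the exponent, and the radius
`√(δ / 6000)` of the ellipsoid gives the first exceptional event probability `δ / 3`. -/
theorem IsStdGaussianNoise.measure_normalEquations_le_delta {d : ℕ} (hd : 1 ≤ d)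
    {Ω : Type*} [MeasurableSpace Ω] {μ : Measure Ω} [IsProbabilityMeasure μ]
    {η : ℕ → Ω → EuclideanSpace ℝ (Fin d)}
    (a : EuclideanSpace ℝ (Fin d) →L[ℝ] EuclideanSpace ℝ (Fin d))
    (h : IsStdGaussianNoise η μ) {k T : ℕ} (hk : 1 ≤ k) (hkT : k ≤ T)
    {L M : EuclideanSpace ℝ (Fin d) →ₗ[ℝ] EuclideanSpace ℝ (Fin d)}
    (hLdet : LinearMap.det L ≠ 0) (hMdet : LinearMap.det M ≠ 0)
    (hL : ∀ w, (gramianForm a k w : ℝ) = ‖L w‖ ^ 2) (hM : ∀ w, (gramianForm a T w : ℝ) = ‖M w‖ ^ 2)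
    {l : ℝ} (hl : 0 < l) (hl' : ∀ w, l * ‖w‖ ^ 2 ≤ ‖L w‖ ^ 2) {δ K : ℝ} (hδ : 0 < δ)
    (hδ' : δ < 1 / 2)
    (hK : K = d * Real.log (d / δ) + 2 * Real.log (|LinearMap.det M| / |LinearMap.det L|))
    (hTk : 30 * K ≤ (T : ℝ) / k) :
    μ {ω | ∃ D, NormalEquations (fun t => linearResponse a η 0 t ω) (fun t => η t ω) T D ∧
      1200 / √(T * l) * √K < ‖D‖} ≤ ENNReal.ofReal δ := by
  have hT : 1 ≤ T := hk.trans hkT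
  have hT0 : (0 : ℝ) < T := by exact_mod_cast hT
  have hk0 : (0 : ℝ) < k := by exact_mod_cast hk
  have hd0 : (1 : ℝ) ≤ d := by exact_mod_cast hd
  have hLM : ∀ w, ‖L w‖ ≤ ‖M w‖ := fun w => by
    have h1 : (gramianForm a k w : ℝ) ≤ gramianForm a T w := by
      exact_mod_cast gramianForm_mono a w hkT
    rw [hL, hM] at h1
    exact (pow_le_pow_iff_left₀ (norm_nonneg _) (norm_nonneg _) two_ne_zero).1 h1
  set pL := |LinearMap.det L| with hpL
  set pM := |LinearMap.det M| with hpM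
  have hpL0 : 0 < pL := abs_pos.2 hLdet
  have hpM0 : 0 < pM := abs_pos.2 hMdet
  have hρ : 1 ≤ pM / pL := (one_le_div hpL0).2 (abs_det_le_of_norm_le L M hLdet hMdet hLM)
  have hK0 : 0 ≤ K := by
    rw [hK]
    have h1 : 0 ≤ Real.log (d / δ) := Real.log_nonneg ((one_le_div hδ).2 (by linarith))
    have h2 := Real.log_nonneg hρ
    positivity
  set n : ℕ := T / k - 1 with hn
  have hdiv : 1 ≤ T / k := (Nat.one_le_div_iff hk).2 hkT
  have hn1 : k * (n + 1) ≤ T + 1 := by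
    have : n + 1 = T / k := by lia
    rw [this]
    exact (Nat.mul_div_le T k).trans (Nat.le_succ T)
  have hn2 : (T : ℝ) / k ≤ n + 2 := by
    have h1 : T < k * (T / k + 1) := Nat.lt_mul_div_succ T hk
    have h2 : T / k + 1 = n + 2 := by lia
    rw [h2] at h1
    rw [div_le_iff₀ hk0]
    have : (T : ℝ) < k * (n + 2) := by exact_mod_cast h1
    linarith
  set r := √(δ / 6000) with hr
  have hr0 : 0 < r := Real.sqrt_pos.2 (by positivity)
  have hr2 : r ^ 2 = δ / 6000 := Real.sq_sqrt (by positivity)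
  have hr' : r ≤ 1 / 2 := by nlinarith
  set m := 1200 / √(T * l) * √K with hm
  have hm0 : 0 ≤ m := by positivity
  have hm2 : m ^ 2 = 1440000 * K / (T * l) := by
    rw [hm, mul_pow, div_pow, Real.sq_sqrt hK0, Real.sq_sqrt (by positivity)]
    ring
  have hΘ : 19 * K ≤ 1 / 1000 * T * l * m ^ 2 / 64 := by
    rw [hm2]
    have : 1 / 1000 * T * l * (1440000 * K / (T * l)) / 64 = 22.5 * K := by
      field_simp; ring
    rw [this]; linarith
  refine (h.measure_normalEquations_le a hk hT hn1 hMdet hL hM hLM hl.le hl'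
    (α := 1 / 1000) (by norm_num) hr0 hr' hm0).trans ?_
  set V := √Real.pi ^ d / Real.Gamma ((d : ℝ) / 2 + 1) with hV
  have hV0 : 0 < V := by
    have := Real.Gamma_pos_of_pos (show (0 : ℝ) < (d : ℝ) / 2 + 1 by positivity)
    have := Real.pi_pos
    positivity
  have hball : ∀ s : ℝ, 0 < s → volume (Metric.ball (0 : EuclideanSpace ℝ (Fin d)) s)
      = ENNReal.ofReal (s ^ d * V) := fun s hs => by
    rw [Measure.addHaar_ball_of_pos _ _ hs, volume_unitBall_euclideanSpace d hd,
      ← ENNReal.ofReal_mul (by positivity), finrank_euclideanSpace_fin]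
  have h2' : ∀ s : ℝ, ENNReal.ofReal s / 2 = ENNReal.ofReal (s / 2) := fun s => by
    rw [ENNReal.ofReal_div_of_pos two_pos, ENNReal.ofReal_ofNat]
  rw [volume_setOf_norm_linearMap_le M hMdet hr0.le,
    volume_setOf_norm_linearMap_le L hLdet (by norm_num), lintegral_exp_neg_norm_linearMap_sq L hLdet,
    hball 2 two_pos, hball (1 / 4) (by norm_num), volume_unitBall_euclideanSpace d hd, ← hV,
    finrank_euclideanSpace_fin, abs_inv, abs_inv, ← hpL, ← hpM]
  rw [← ENNReal.ofReal_mul (p := pL⁻¹ * (3 / 2) ^ d) (by positivity),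
    ← ENNReal.ofReal_mul (p := pM⁻¹ * r ^ d) (by positivity), h2',
    ← ENNReal.ofReal_mul (by positivity), ← ENNReal.ofReal_mul (by positivity),
    ← ENNReal.ofReal_mul (by positivity), ← ENNReal.ofReal_mul (by positivity),
    ← ENNReal.ofReal_mul (by positivity), ← ENNReal.ofReal_div_of_pos (by positivity),
    ← ENNReal.ofReal_div_of_pos (by positivity), ← ENNReal.ofReal_add (by positivity) (by positivity),
    ← ENNReal.ofReal_add (by positivity) (by positivity)]
  refine ENNReal.ofReal_le_ofReal ?_
  have t1 : 2 * r ^ 2 / (1 / 1000) = δ / 3 := by rw [hr2]; ring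
  have t2 := small_ball_term_le hd hδ hδ' hρ hK hTk hn2
  have t3 := cross_term_le hd hδ hδ' hρ hK hΘ
  have e2 : (1 / 2) ^ n * (pL⁻¹ * (3 / 2) ^ d * V) /
      (pM⁻¹ * r ^ d * V / 2 * Real.exp (-(4 * (6 / k) * (1 / 1000 * T))))
      = (1 / 2) ^ n * (pM / pL * (3 / 2) ^ d) / (r ^ d / 2 * Real.exp (-(24 / 1000 * (T / k)))) := by
    rw [show (4 * (6 / (k : ℝ)) * (1 / 1000 * T)) = 24 / 1000 * (T / k) by ring]
    field_simp
  have e3 : 2 ^ d * V * (pL⁻¹ * √(2 * Real.pi) ^ d) /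
      ((1 / 4) ^ d * V * (pM⁻¹ * r ^ d * V / 2 * Real.exp (1 / 1000 * T * l * m ^ 2 / 64 - 1)))
      = 2 ^ d * (pM / pL * √(2 * Real.pi) ^ d) /
        ((1 / 4) ^ d * (r ^ d * V / 2 * Real.exp (1 / 1000 * T * l * m ^ 2 / 64 - 1))) := by
    field_simp
  rw [t1, e2, e3]
  linarith

/-! ### Gramians, eigenvalues and least squares in coordinates -/

section Matrices

open scoped RealInnerProductSpace

variable {d : ℕ}

theorem toEuclideanCLM_transpose (B : Matrix (Fin d) (Fin d) ℝ) :
    Matrix.toEuclideanCLM (𝕜 := ℝ) B.transpose = (Matrix.toEuclideanCLM (𝕜 := ℝ) B).adjoint :=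
  map_star (Matrix.toEuclideanCLM (n := Fin d) (𝕜 := ℝ)) B

theorem gramianForm_eq_inner (A : Matrix (Fin d) (Fin d) ℝ) (k : ℕ) (w : EuclideanSpace ℝ (Fin d)) :
    (gramianForm (Matrix.toEuclideanCLM (𝕜 := ℝ) A) k w : ℝ)
      = ⟪w, Matrix.toEuclideanCLM (𝕜 := ℝ) (LinSys.gramian A k) w⟫ := by
  have hadj : ∀ s, (Matrix.toEuclideanCLM (𝕜 := ℝ) A).adjoint ^ s
      = (Matrix.toEuclideanCLM (𝕜 := ℝ) (A ^ s)).adjoint := fun s => by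
    rw [map_pow]
    exact (star_pow (Matrix.toEuclideanCLM (n := Fin d) (𝕜 := ℝ) A) s).symm
  rw [LinSys.gramian, map_sum, sum_apply, inner_sum, gramianForm,
    NNReal.coe_sum]
  refine Finset.sum_congr rfl fun s _ => ?_
  rw [NNReal.coe_pow, coe_nnnorm, map_mul, toEuclideanCLM_transpose, hadj, mul_apply_eq_comp,
    ← ContinuousLinearMap.adjoint_inner_left, real_inner_self_eq_norm_sq]

theorem gramian_posDef (A : Matrix (Fin d) (Fin d) ℝ) {k : ℕ} (hk : 1 ≤ k) :
    (LinSys.gramian A k).PosDef := by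
  refine Matrix.PosDef.of_dotProduct_mulVec_pos (LinSys.gramian_isHermitian A k) fun x hx => ?_
  have h1 := gramianForm_eq_inner A k (WithLp.toLp 2 x)
  rw [Matrix.inner_toEuclideanCLM] at h1
  simp only [star_trivial]
  rw [← h1]
  have hx' : 0 < ‖WithLp.toLp 2 x‖ := norm_pos_iff.2 ((WithLp.toLp_eq_zero 2).not.2 hx)
  exact lt_of_lt_of_le (pow_pos hx' 2) (norm_sq_le_gramianForm _ hk _)

theorem det_toEuclideanCLM (B : Matrix (Fin d) (Fin d) ℝ) :
    LinearMap.det (Matrix.toEuclideanCLM (𝕜 := ℝ) B :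
      EuclideanSpace ℝ (Fin d) →ₗ[ℝ] EuclideanSpace ℝ (Fin d)) = B.det := by
  rw [Matrix.coe_toEuclideanCLM_eq_toEuclideanLin, Matrix.toEuclideanLin_eq_toLin_orthonormal,
    LinearMap.det_toLin]

open scoped MatrixOrder in
/-- A square root of the Gramian, as a linear map. -/
theorem exists_gramianForm_eq_norm_sq (A : Matrix (Fin d) (Fin d) ℝ) {k : ℕ} (hk : 1 ≤ k) :
    ∃ L : EuclideanSpace ℝ (Fin d) →ₗ[ℝ] EuclideanSpace ℝ (Fin d),
      LinearMap.det L ≠ 0 ∧ LinearMap.det L ^ 2 = (LinSys.gramian A k).det ∧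
      ∀ w, (gramianForm (Matrix.toEuclideanCLM (𝕜 := ℝ) A) k w : ℝ) = ‖L w‖ ^ 2 := by
  have hp := gramian_posDef A hk
  obtain ⟨B, hB⟩ := CStarAlgebra.nonneg_iff_eq_star_mul_self.mp hp.posSemidef.nonneg
  have hB' : LinSys.gramian A k = B.transpose * B := hB
  have hdet : B.det ^ 2 = (LinSys.gramian A k).det := by
    rw [hB', Matrix.det_mul, Matrix.det_transpose, sq]
  refine ⟨Matrix.toEuclideanCLM (𝕜 := ℝ) B, ?_, ?_, fun w => ?_⟩
  · rw [det_toEuclideanCLM]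
    intro h0
    rw [h0] at hdet
    exact hp.det_pos.ne' (by rw [← hdet]; norm_num)
  · rw [det_toEuclideanCLM, hdet]
  · rw [gramianForm_eq_inner, hB', map_mul, toEuclideanCLM_transpose,
      mul_apply_eq_comp, ContinuousLinearMap.adjoint_inner_right,
      real_inner_self_eq_norm_sq]
    rfl

theorem gramianLambdaMin_pos (hd : 1 ≤ d) (A : Matrix (Fin d) (Fin d) ℝ) {k : ℕ} (hk : 1 ≤ k) :
    0 < LinSys.gramianLambdaMin A k := by
  have : Nonempty (Fin d) := ⟨⟨0, hd⟩⟩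
  obtain ⟨i, hi⟩ := exists_eq_ciInf_of_finite (f := (LinSys.gramian_isHermitian A k).eigenvalues)
  rw [LinSys.gramianLambdaMin, ← hi]
  exact (gramian_posDef A hk).eigenvalues_pos i

theorem gramianLambdaMin_mul_le (A : Matrix (Fin d) (Fin d) ℝ) (k : ℕ)
    (w : EuclideanSpace ℝ (Fin d)) :
    LinSys.gramianLambdaMin A k * ‖w‖ ^ 2
      ≤ gramianForm (Matrix.toEuclideanCLM (𝕜 := ℝ) A) k w := by
  set hH := LinSys.gramian_isHermitian A k
  set b := hH.eigenvectorBasis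
  have hb : ∀ i, Matrix.toEuclideanCLM (𝕜 := ℝ) (LinSys.gramian A k) (b i)
      = hH.eigenvalues i • b i := fun i => by
    apply (WithLp.ofLp_injective 2)
    rw [Matrix.ofLp_toEuclideanCLM, hH.mulVec_eigenvectorBasis]
    rfl
  have hself : ∀ x y, ⟪x, Matrix.toEuclideanCLM (𝕜 := ℝ) (LinSys.gramian A k) y⟫
      = ⟪Matrix.toEuclideanCLM (𝕜 := ℝ) (LinSys.gramian A k) x, y⟫ := fun x y => by
    rw [← ContinuousLinearMap.adjoint_inner_left, ← toEuclideanCLM_transpose,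
      ← Matrix.conjTranspose_eq_transpose_of_trivial, hH.eq]
  rw [gramianForm_eq_inner, ← b.sum_inner_mul_inner, ← b.sum_sq_norm_inner_right, Finset.mul_sum]
  refine Finset.sum_le_sum fun i _ => ?_
  rw [hself, hb, inner_smul_left, real_inner_comm, Real.norm_eq_abs, sq_abs]
  have : LinSys.gramianLambdaMin A k ≤ hH.eigenvalues i :=
    ciInf_le (Set.finite_range _).bddBelow i
  simp only [RCLike.conj_to_real]
  nlinarith [sq_nonneg ⟪b i, w⟫]

/-- First-order optimality of least squares under rank-one perturbations. -/
theorem LinSys.IsOLS.normalEquations {x e : ℕ → EuclideanSpace ℝ (Fin d)} {T : ℕ}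
    {A Ahat : Matrix (Fin d) (Fin d) ℝ} (h : LinSys.IsOLS x T Ahat)
    (hx : ∀ t, x (t + 1) = Matrix.toEuclideanCLM (𝕜 := ℝ) A (x t) + e t) :
    NormalEquations x e T (Matrix.toEuclideanCLM (𝕜 := ℝ) (Ahat - A)) := by
  intro v w
  set f : ℕ → EuclideanSpace ℝ (Fin d) :=
    fun t => x (t + 1) - Matrix.toEuclideanCLM (𝕜 := ℝ) Ahat (x t) with hf
  have hpert : ∀ ε : ℝ, ∀ t, x (t + 1) - Matrix.toEuclideanCLM (𝕜 := ℝ)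
      (Ahat + ε • Matrix.vecMulVec v w) (x t) = f t - (ε * ⟪w, x t⟫) • v := by
    intro ε t
    have : Matrix.toEuclideanCLM (𝕜 := ℝ) (Matrix.vecMulVec v w) (x t) = ⟪w, x t⟫ • v := by
      apply (WithLp.ofLp_injective 2)
      rw [Matrix.ofLp_toEuclideanCLM, Matrix.vecMulVec_mulVec]
      ext i
      simp [PiLp.inner_apply, dotProduct, mul_comm]
    rw [map_add, map_smul, add_apply, smul_apply, this,
      smul_smul, hf]
    exact sub_add_eq_sub_sub _ _ _
  set P := ∑ t ∈ Finset.Icc 1 T, ⟪w, x t⟫ * ⟪f t, v⟫ with hP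
  set Q := ∑ t ∈ Finset.Icc 1 T, ⟪w, x t⟫ ^ 2 * ‖v‖ ^ 2 with hQ
  have hquad : ∀ ε : ℝ, 0 ≤ -ε * P + ε ^ 2 / 2 * Q := by
    intro ε
    have h1 := h (Ahat + ε • Matrix.vecMulVec v w)
    simp only [LinSys.olsLoss, hpert] at h1
    have h2 : ∑ t ∈ Finset.Icc 1 T, (1 / 2 : ℝ) * ‖f t - (ε * ⟪w, x t⟫) • v‖ ^ 2
        = ∑ t ∈ Finset.Icc 1 T, (1 / 2 : ℝ) * ‖f t‖ ^ 2 + (-ε * P + ε ^ 2 / 2 * Q) := by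
      rw [hP, hQ, Finset.mul_sum, Finset.mul_sum, ← Finset.sum_add_distrib,
        ← Finset.sum_add_distrib]
      refine Finset.sum_congr rfl fun t _ => ?_
      rw [norm_sub_sq_real, inner_smul_right, norm_smul, mul_pow, Real.norm_eq_abs, sq_abs]
      ring
    rw [h2] at h1
    linarith
  have hQ0 : 0 ≤ Q := Finset.sum_nonneg fun _ _ => by positivity
  have hP0 : P = 0 := by
    -- test the quadratic inequality at a small multiple of `P`
    have h1 := hquad (P / (Q + 1))
    have h2 : -(P / (Q + 1)) * P + (P / (Q + 1)) ^ 2 / 2 * Q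
        = -(P ^ 2 * (Q + 2)) / (2 * (Q + 1) ^ 2) := by
      field_simp; ring
    rw [h2, le_div_iff₀ (by positivity)] at h1
    have h3 : P ^ 2 ≤ 0 := by nlinarith [sq_nonneg P]
    exact pow_eq_zero_iff two_ne_zero |>.1 (le_antisymm h3 (sq_nonneg P))
  rw [← sub_eq_zero, ← Finset.sum_sub_distrib, ← hP0, hP]
  refine Finset.sum_congr rfl fun t _ => ?_
  rw [hf]
  simp only [hx, map_sub, sub_apply, real_inner_comm v, inner_add_right,
    inner_sub_right]
  ring

end Matrices

section Law

open scoped RealInnerProductSpace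

theorem map_inner_smul_multivariateGaussian {d : ℕ} {σ : ℝ} (hσ : σ ≠ 0)
    (u : EuclideanSpace ℝ (Fin d)) :
    (multivariateGaussian 0 (σ ^ 2 • (1 : Matrix (Fin d) (Fin d) ℝ))).map
      (fun x => ⟪u, σ⁻¹ • x⟫) = gaussianReal 0 (‖u‖₊ ^ 2) := by
  have hm : Measurable fun x : EuclideanSpace ℝ (Fin d) => ⟪u, σ⁻¹ • x⟫ := by fun_prop
  have : IsProbabilityMeasure ((multivariateGaussian 0
      (σ ^ 2 • (1 : Matrix (Fin d) (Fin d) ℝ))).map (fun x => ⟪u, σ⁻¹ • x⟫)) :=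
    Measure.isProbabilityMeasure_map hm.aemeasurable
  refine Measure.ext_of_charFun (funext fun t => ?_)
  have hS : (σ ^ 2 • (1 : Matrix (Fin d) (Fin d) ℝ)).PosSemidef :=
    Matrix.PosSemidef.one.smul (sq_nonneg σ)
  have h1 := charFun_multivariateGaussian (μ := 0) hS ((t * σ⁻¹) • u)
  rw [charFun_gaussianReal, charFun_apply_real, integral_map hm.aemeasurable (by fun_prop)]
  rw [charFun_apply] at h1
  have h2 : ∀ x : EuclideanSpace ℝ (Fin d), (t : ℂ) * ((⟪u, σ⁻¹ • x⟫ : ℝ) : ℂ)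
      = ((⟪x, (t * σ⁻¹) • u⟫ : ℝ) : ℂ) := fun x => by
    rw [inner_smul_right, inner_smul_right, real_inner_comm]
    push_cast; ring
  simp only [h2, h1]
  have h3 : ((t * σ⁻¹) • u).ofLp ⬝ᵥ (σ ^ 2 • (1 : Matrix (Fin d) (Fin d) ℝ)).mulVec
      ((t * σ⁻¹) • u).ofLp = t ^ 2 * ‖u‖ ^ 2 := by
    rw [EuclideanSpace.real_norm_sq_eq, Matrix.smul_mulVec, Matrix.one_mulVec]
    simp only [dotProduct, PiLp.smul_apply, Pi.smul_apply, smul_eq_mul, Finset.mul_sum]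
    refine Finset.sum_congr rfl fun i _ => ?_
    field_simp
  rw [h3]
  simp only [inner_zero_right]
  congr 1
  push_cast
  ring

end Law

theorem theorem1 :
    ∃ c C : ℝ, 0 < c ∧ 0 < C ∧
      ∀ (δ : ℝ), 0 < δ → δ < 1 / 2 →
      ∀ (d : ℕ), 1 ≤ d →
      ∀ (A : Matrix (Fin d) (Fin d) ℝ),
        spectralRadius ℂ (A.map (algebraMap ℝ ℂ)) ≤ 1 →
      ∀ (σ : ℝ), 0 < σ →
      ∀ (Ω : Type*) [MeasurableSpace Ω] (μ : Measure Ω) [IsProbabilityMeasure μ]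
        (η X : ℕ → Ω → EuclideanSpace ℝ (Fin d)),
        iIndepFun η μ →
        (∀ t, HasLaw (η t)
          (multivariateGaussian 0 (σ ^ 2 • (1 : Matrix (Fin d) (Fin d) ℝ))) μ) →
        (∀ ω, X 0 ω = 0) →
        (∀ t ω, X (t + 1) ω = Matrix.toEuclideanCLM (𝕜 := ℝ) A (X t ω) + η t ω) →
      ∀ (T k : ℕ), 1 ≤ k → k ≤ T →
        c * LinSys.complexityTerm A δ T k ≤ (T : ℝ) / k →
      ∀ (Ahat : Ω → Matrix (Fin d) (Fin d) ℝ),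
        (∀ ω, LinSys.IsOLS (fun t => X t ω) T (Ahat ω)) →
        μ {ω | C / Real.sqrt (T * LinSys.gramianLambdaMin A k)
            * Real.sqrt (LinSys.complexityTerm A δ T k) < LinSys.opNorm (Ahat ω - A)}
          ≤ ENNReal.ofReal δ := by
  refine ⟨30, 1200, by norm_num, by norm_num, ?_⟩
  intro δ hδ hδ' d hd A _ σ hσ Ω _ μ _ η X hind hlaw hX0 hX T k hk hkT hTk Ahat hols
  set a := Matrix.toEuclideanCLM (𝕜 := ℝ) A with ha
  have hae := fun t => (hlaw t).aemeasurable
  -- the normalised noise, modified on a null set so as to be measurable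
  set ξ : ℕ → Ω → EuclideanSpace ℝ (Fin d) := fun t ω => σ⁻¹ • (hae t).mk (η t) ω with hξ
  have hξη : ∀ᵐ ω ∂μ, ∀ t, η t ω = σ • ξ t ω := by
    rw [ae_all_iff]
    intro t
    filter_upwards [(hae t).ae_eq_mk] with ω hω
    rw [hξ]
    simp only [smul_smul, mul_inv_cancel₀ hσ.ne', one_smul]
    exact hω
  have hnoise : IsStdGaussianNoise ξ μ := by
    refine ⟨fun t => by
      have := (hae t).measurable_mk
      fun_prop, ?_, fun t u => ?_⟩
    · exact (hind.congr fun t => (hae t).ae_eq_mk).comp (fun _ x => σ⁻¹ • x)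
        fun _ => measurable_const_smul _
    · rw [← map_inner_smul_multivariateGaussian hσ.ne' u, ← (hlaw t).map_eq,
        Measure.map_congr (hae t).ae_eq_mk,
        Measure.map_map (by fun_prop) (hae t).measurable_mk]
      rfl
  obtain ⟨L, hLdet, hLsq, hL⟩ := exists_gramianForm_eq_norm_sq A hk
  obtain ⟨M, hMdet, hMsq, hM⟩ := exists_gramianForm_eq_norm_sq A (hk.trans hkT)
  have hK : LinSys.complexityTerm A δ T k
      = d * Real.log (d / δ) + 2 * Real.log (|LinearMap.det M| / |LinearMap.det L|) := by
    rw [LinSys.complexityTerm, Matrix.det_mul, Matrix.det_nonsing_inv, ← hLsq, ← hMsq,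
      Ring.inverse_eq_inv, ← div_eq_mul_inv, ← div_pow, ← abs_div, Real.log_abs, Real.log_pow]
    norm_num
  refine le_trans (measure_mono_ae ?_) (hnoise.measure_normalEquations_le_delta hd a hk hkT hLdet
    hMdet hL hM (gramianLambdaMin_pos hd A hk)
    (fun w => (gramianLambdaMin_mul_le A k w).trans (hL w).le) hδ hδ' hK hTk)
  filter_upwards [hξη] with ω hω
  intro hbad
  refine ⟨Matrix.toEuclideanCLM (𝕜 := ℝ) (Ahat ω - A), ?_, hbad⟩
  have hXξ : ∀ t, X t ω = σ • linearResponse a ξ 0 t ω := by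
    intro t
    induction t with
    | zero => simp [hX0, linearResponse]
    | succ t ih => rw [hX, ih, hω, linearResponse, zero_add, smul_add, map_smul]
  have hne := (hols ω).normalEquations (e := fun t => η t ω) fun t => hX t ω
  intro v w
  have h1 := hne v w
  simp only [hXξ, hω, map_smul, inner_smul_right] at h1
  have h2 : ∀ f g : ℕ → ℝ, ∑ t ∈ Finset.Icc 1 T, σ * f t * (σ * g t)
      = σ ^ 2 * ∑ t ∈ Finset.Icc 1 T, f t * g t := fun f g => by
    rw [Finset.mul_sum]
    exact Finset.sum_congr rfl fun t _ => by ring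
  rw [h2, h2] at h1
  exact mul_left_cancel₀ (pow_ne_zero 2 hσ.ne') h1
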